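/- A (one-way) nondeterministic one-counter machine $M$ has a finite input alphabet $\Sigma$, finitely many states, a start state, a set of final states, and a counter that holds a nonnegative integer and is initially zero. It has finitely many moves; each move depends on the state, on the next input symbol (unless it reads nothing) and on whether the counter is zero, and it changes the state and adds $-1$, $0$ or $1$ to the counter (subtracting from a zero counter is not possible). $M$ accepts a word $w \in \Sigma^*$ if some computation reads all of $w$ and ends in a final state; $L(M) \subseteq \Sigma^*$ is the set of accepted words and $\overline{L(M)} = \Sigma^* \setminus L(M)$. $M$ is real-time if every move reads an input symbol, and $M$ is an $\mathrm{NCM}(1,1)$ if in every computation, on every input, the counter changes between non-decreasing and non-increasing at most once. A language $L$ over a finite alphabet is counting-regular if there is a regular language $L'$ over some finite alphabet (possibly different from that of $L$) such that, for all $n \ge 0$, $L$ and $L'$ contain the same number of words of length $n$. Theorem. It is undecidable, given a real-time $\mathrm{NCM}(1,1)$ $M$, whether $\overline{L(M)}$ is counting-regular. It is also undecidable, given a real-time $\mathrm{NCM}(1,1)$ $M$, whether $L(M)$ is counting-regular. That is, for neither of the two problems is there an algorithm that halts with the correct answer on every real-time $\mathrm{NCM}(1,1)$. -/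

import Mathlib

/-! Counting functions and counting-regular languages. -/

/-- The counting function `f_L`: the number of words of length `n` in `L`
(a finite number, since it is used for languages over finite alphabets only). -/
noncomputable def countWords {α : Type} (L : Language α) (n : ℕ) : ℕ :=
  Set.ncard {w : List α | w ∈ L ∧ w.length = n}

/-- `L` is counting-regular if some regular language, over a finite alphabet which need not be
the alphabet of `L`, has the same counting function. -/
def CountingRegular {α : Type} (L : Language α) : Prop :=
  ∃ (β : Type) (_ : Finite β) (L' : Language β),
    L'.IsRegular ∧ ∀ n : ℕ, countWords L n = countWords L' n

/-! One-way nondeterministic one-counter machines. -/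

/-- What a move does to the counter: subtract one, leave it alone, or add one. -/
inductive CounterOp : Type where
  | dec : CounterOp
  | keep : CounterOp
  | inc : CounterOp
  deriving DecidableEq

namespace CounterOp

/-- The new value of the counter. Subtracting one from zero is impossible. -/
def apply : CounterOp → ℕ → Option ℕ
  | dec, 0 => none
  | dec, c + 1 => some c
  | keep, c => some c
  | inc, c => some (c + 1)

def equivFin : CounterOp ≃ Fin 3 where
  toFun
    | dec => 0
    | keep => 1
    | inc => 2
  invFun
    | 0 => dec
    | 1 => keep
    | 2 => inc
  left_inv x := by cases x <;> rfl
  right_inv x := by fin_cases x <;> rfl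

instance : Primcodable CounterOp := Primcodable.ofEquiv (Fin 3) equivFin

/-- The number of reversals in a sequence of counter operations: drop the operations that leave
the counter alone, and count the changes between consecutive maximal blocks of equal operations. -/
def reversals (l : List CounterOp) : ℕ :=
  ((l.filter (fun o => o ≠ keep)).destutter (fun o o' => o ≠ o')).length - 1

end CounterOp

/-- A move of a one-counter machine. It may be made in the state `source`, if the next input symbol
is `a` in case `read = some a` (with no condition on the input in case `read = none`), and if the
counter is zero in case `ifZero = true`, nonzero in case `ifZero = false`. It consumes the input
symbol `a` if `read = some a` and nothing if `read = none`, performs `op` on the counter, and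
enters the state `target`. -/
structure CounterMove : Type where
  source : ℕ
  read : Option ℕ
  ifZero : Bool
  op : CounterOp
  target : ℕ

def CounterMove.equivProd : CounterMove ≃ ℕ × Option ℕ × Bool × CounterOp × ℕ where
  toFun t := (t.source, t.read, t.ifZero, t.op, t.target)
  invFun p := ⟨p.1, p.2.1, p.2.2.1, p.2.2.2.1, p.2.2.2.2⟩
  left_inv _ := rfl
  right_inv _ := rfl

instance : Primcodable CounterMove :=
  Primcodable.ofEquiv (ℕ × Option ℕ × Bool × CounterOp × ℕ) CounterMove.equivProd

/-- A nondeterministic machine with a one-way input and one counter. The input alphabet is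
`{0, …, alphabetSize - 1}`; the states are named by natural numbers, and the finite state set
consists of the names that occur in the description. -/
structure OneCounterMachine : Type where
  alphabetSize : ℕ
  start : ℕ
  final : List ℕ
  moves : List CounterMove

namespace OneCounterMachine

def equivProd : OneCounterMachine ≃ ℕ × ℕ × List ℕ × List CounterMove where
  toFun M := (M.alphabetSize, M.start, M.final, M.moves)
  invFun p := ⟨p.1, p.2.1, p.2.2.1, p.2.2.2⟩
  left_inv _ := rfl
  right_inv _ := rfl

instance : Primcodable OneCounterMachine :=
  Primcodable.ofEquiv (ℕ × ℕ × List ℕ × List CounterMove) equivProd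

/-- The input alphabet. -/
abbrev Alphabet (M : OneCounterMachine) : Type := Fin M.alphabetSize

/-- `M.Run q c w l q' c'`: from the state `q` and counter value `c`, the machine can get to the
state `q'` and counter value `c'` by a (finite) sequence of moves that consumes exactly the
word `w` and performs the sequence `l` of counter operations. -/
inductive Run (M : OneCounterMachine) :
    ℕ → ℕ → List M.Alphabet → List CounterOp → ℕ → ℕ → Prop
  | refl (q c : ℕ) : Run M q c [] [] q c
  | silent (t : CounterMove) (q c c₁ : ℕ) (w : List M.Alphabet) (l : List CounterOp) (q' c' : ℕ) :
      t ∈ M.moves → t.source = q → t.read = none → (t.ifZero = true ↔ c = 0) →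
      t.op.apply c = some c₁ → Run M t.target c₁ w l q' c' → Run M q c w (t.op :: l) q' c'
  | read (t : CounterMove) (a : M.Alphabet) (q c c₁ : ℕ) (w : List M.Alphabet)
      (l : List CounterOp) (q' c' : ℕ) :
      t ∈ M.moves → t.source = q → t.read = some (a : ℕ) → (t.ifZero = true ↔ c = 0) →
      t.op.apply c = some c₁ → Run M t.target c₁ w l q' c' → Run M q c (a :: w) (t.op :: l) q' c'

/-- The accepted language: the words that can be consumed completely, starting in the start state
with the counter at zero and ending in a final state. -/
def language (M : OneCounterMachine) : Language M.Alphabet :=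
  {w | ∃ (l : List CounterOp) (q c : ℕ), M.Run M.start 0 w l q c ∧ q ∈ M.final}

/-- Every move consumes an input symbol. -/
def IsRealTime (M : OneCounterMachine) : Prop :=
  ∀ t ∈ M.moves, t.read ≠ none

/-- No computation, accepting or not, makes more than `t` counter reversals. (Computations on an
initial part of an input are covered, as every word is an input.) -/
def IsReversalBounded (M : OneCounterMachine) (t : ℕ) : Prop :=
  ∀ (w : List M.Alphabet) (l : List CounterOp) (q c : ℕ),
    M.Run M.start 0 w l q c → CounterOp.reversals l ≤ t

/-- The real-time machines of the class `NCM(1,1)`: one counter, at most one reversal. -/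
def IsRealTimeNCM11 (M : OneCounterMachine) : Prop :=
  M.IsRealTime ∧ M.IsReversalBounded 1

end OneCounterMachine

/-- The problem "given an instance `a` in the class `C`, does `P a` hold?" is decidable: some
algorithm halts on every instance in `C` and answers correctly there (on inputs outside `C` it may
do anything, or diverge). -/
def DecidableProblem {α : Type} [Primcodable α] (C P : α → Prop) : Prop :=
  ∃ f : α →. Bool, Partrec f ∧ ∀ a : α, C a → ∃ b ∈ f a, (b = true ↔ P a)

/-! Counting functions of regular languages satisfy linear recurrences. -/

/-! The halting problem is reduced to both questions by one map. A fixed universal stack machine is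
turned into a `RuleSystem`: each stack is a number in base `Nat.card A + 1`, each elementary
statement is an affine rule on the vector of stack codes, and one further entry is a clock. A
history lists the successive vectors in unary, in any order of letters, each followed by the rule
applied to it. A real-time one-counter machine accepts exactly the words that are not histories
(`accepts_start_iff`): it guesses one error and verifies it, and a false value of a single entry is
found by counting up through one vector and down through the next, hence with one reversal. The
input occurs only in the check of the first vector.

If the computation halts, there are finitely many histories, so the accepted language and its
complement are both regular. If it does not, there are histories with any number `m` of steps, and
their length depends on `m` alone. The clock makes the vectors grow, so the counting function of the
histories has arbitrarily long intervals of zeros without being eventually zero.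

The counting function of a regular language satisfies a linear recurrence (Cayley-Hamilton), so a
sufficiently long interval of zeros makes it vanish from there on. Hence the histories are not
counting-regular. Their complement has counting function `f n = k ^ n - h n`, where `h` counts
histories and `k` is the number of letters; `f (n + 1) - k * f n` satisfies the recurrence of `f`
and vanishes inside the gaps of `h`, which again would force `h` to be eventually zero. -/

theorem DFA.ncard_evalFrom_succ {α σ : Type} [Fintype α] (M : DFA α σ) (s : σ) (n : ℕ) :
    Set.ncard {w : List α | M.evalFrom s w ∈ M.accept ∧ w.length = n + 1} =
      ∑ a, Set.ncard {w : List α | M.evalFrom (M.step s a) w ∈ M.accept ∧ w.length = n} := by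
  have hfin : ∀ t : σ, Finite {w : List α | M.evalFrom t w ∈ M.accept ∧ w.length = n} :=
    fun t => ((List.finite_length_eq α n).subset fun w hw => hw.2).to_subtype
  simp only [← Nat.card_coe_set_eq]
  rw [← Nat.card_sigma]
  refine Nat.card_congr (Equiv.symm ?_)
  refine Equiv.ofBijective
    (fun p => ⟨p.1 :: p.2.1, p.2.2.1, by simpa using p.2.2.2⟩) ⟨?_, ?_⟩
  · rintro ⟨a, w, hw⟩ ⟨b, v, hv⟩ h
    simp only [Subtype.mk.injEq, List.cons.injEq] at h
    obtain ⟨rfl, rfl⟩ := h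
    rfl
  · rintro ⟨w, hw, hl⟩
    cases w with
    | nil => simp at hl
    | cons a w => exact ⟨⟨a, w, hw, by simpa using hl⟩, rfl⟩

/-- The sequence `f` satisfies a monic linear recurrence of order `d` with integer coefficients. -/
def LinearlyRecurrent (f : ℕ → ℤ) (d : ℕ) : Prop :=
  ∃ c : ℕ → ℤ, ∀ n, f (n + d) = ∑ i ∈ Finset.range d, c i * f (n + i)

theorem LinearlyRecurrent.eq_zero {f : ℕ → ℤ} {d m : ℕ} (h : LinearlyRecurrent f d)
    (h0 : ∀ i < d, f (m + i) = 0) (n : ℕ) : f (m + n) = 0 := by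
  obtain ⟨c, hc⟩ := h
  induction n using Nat.strong_induction_on with
  | _ n ih =>
    by_cases hn : n < d
    · exact h0 n hn
    · have := hc (m + (n - d))
      rw [show m + (n - d) + d = m + n by omega] at this
      rw [this]
      refine Finset.sum_eq_zero fun i hi => ?_
      rw [Finset.mem_range] at hi
      rw [add_assoc, ih (n - d + i) (by omega), mul_zero]

theorem LinearlyRecurrent.sub_mul_shift {f : ℕ → ℤ} {d : ℕ} (h : LinearlyRecurrent f d) (k : ℤ) :
    LinearlyRecurrent (fun n => f (n + 1) - k * f n) d := by
  obtain ⟨c, hc⟩ := h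
  refine ⟨c, fun n => ?_⟩
  have h1 := hc (n + 1)
  rw [show n + 1 + d = n + d + 1 by omega] at h1
  simp only [h1, hc n, Finset.mul_sum, ← Finset.sum_sub_distrib]
  refine Finset.sum_congr rfl fun i _ => ?_
  rw [show n + 1 + i = n + i + 1 by omega]
  ring

/-- The vector of counts from all states evolves by the transfer operator `T` of the automaton. The
characteristic polynomial of `T` annihilates it, and being monic it is a recurrence. -/
theorem Language.IsRegular.linearlyRecurrent {α : Type} [Finite α] {L : Language α}
    (hL : L.IsRegular) : ∃ d, LinearlyRecurrent (fun n => (countWords L n : ℤ)) d := by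
  classical
  obtain ⟨σ, _, M, rfl⟩ := hL
  have := Fintype.ofFinite α
  let T : (σ → ℤ) →ₗ[ℤ] (σ → ℤ) :=
    { toFun := fun v s => ∑ a, v (M.step s a)
      map_add' := fun u v => by ext s; simp [Finset.sum_add_distrib]
      map_smul' := fun k v => by ext s; simp [Finset.mul_sum] }
  let v : ℕ → σ → ℤ := fun n s =>
    (Set.ncard {w : List α | M.evalFrom s w ∈ M.accept ∧ w.length = n} : ℤ)
  have hv1 : ∀ n, v (n + 1) = T (v n) := fun n => by
    ext s
    simp only [v, T, LinearMap.coe_mk, AddHom.coe_mk]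
    exact_mod_cast M.ncard_evalFrom_succ s n
  have hvk : ∀ n k, v (n + k) = (T ^ k) (v n) := fun n k => by
    induction k with
    | zero => simp
    | succ k ih => rw [← add_assoc, hv1, ih, pow_succ']; rfl
  refine ⟨T.charpoly.natDegree, fun i => -T.charpoly.coeff i, fun n => ?_⟩
  have hcount : ∀ n, (countWords M.accepts n : ℤ) = v n M.start := fun n => rfl
  -- Cayley-Hamilton, applied to the vector `v n` and read off at the start state.
  have hch := congrArg (fun S : (σ → ℤ) →ₗ[ℤ] (σ → ℤ) => S (v n) M.start)
    T.aeval_self_charpoly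
  simp only [Polynomial.aeval_eq_sum_range, Finset.sum_range_succ, LinearMap.add_apply,
    LinearMap.zero_apply, Pi.add_apply, Pi.zero_apply, LinearMap.smul_apply, Pi.smul_apply,
    LinearMap.sum_apply, Finset.sum_apply, ← hvk, smul_eq_mul] at hch
  rw [T.charpoly_monic.coeff_natDegree] at hch
  simp only [hcount, neg_mul, Finset.sum_neg_distrib]
  linarith

theorem CountingRegular.linearlyRecurrent {α : Type} {L : Language α} (hL : CountingRegular L) :
    ∃ d, LinearlyRecurrent (fun n => (countWords L n : ℤ)) d := by
  obtain ⟨β, _, L', hL', h⟩ := hL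
  simp only [h]
  exact hL'.linearlyRecurrent

/-- A counting-regular language whose counting function vanishes on arbitrarily long intervals
has no long words. -/
theorem CountingRegular.eventually_zero {α : Type} {L : Language α} (hL : CountingRegular L)
    (hgap : ∀ d, ∃ m, ∀ i < d, countWords L (m + i) = 0) :
    ∃ m, ∀ n, countWords L (m + n) = 0 := by
  obtain ⟨d, hd⟩ := hL.linearlyRecurrent
  obtain ⟨m, hm⟩ := hgap d
  refine ⟨m, fun n => ?_⟩
  exact_mod_cast hd.eq_zero (m := m) (fun i hi => by exact_mod_cast hm i hi) n

theorem countWords_add_countWords_compl {α : Type} [Fintype α] (L : Language α) (n : ℕ) :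
    countWords L n + countWords Lᶜ n = Fintype.card α ^ n := by
  have hfin := List.finite_length_eq α n
  have hcard : Set.ncard {w : List α | w.length = n} = Fintype.card α ^ n := by
    rw [← Nat.card_coe_set_eq]
    change Nat.card (List.Vector α n) = _
    rw [Nat.card_eq_fintype_card, card_vector]
  rw [← hcard, countWords, countWords, ← Set.ncard_union_eq ?_ (hfin.subset fun w hw => hw.2)
    (hfin.subset fun w hw => hw.2)]
  · congr 1
    ext w
    by_cases h : w ∈ L
    · simp [h]
    · have h' : w ∈ Lᶜ := h
      simp [h, h']
  · rw [Set.disjoint_left]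
    rintro w ⟨h, _⟩ ⟨h', _⟩
    exact h' h

/-- The same if the complement is counting-regular. -/
theorem CountingRegular.eventually_zero_of_compl {α : Type} [Fintype α] {L : Language α}
    (hL : CountingRegular Lᶜ) (hgap : ∀ d, ∃ m, ∀ i < d, countWords L (m + i) = 0) :
    ∃ m, ∀ n, countWords L (m + n) = 0 := by
  obtain ⟨d, hd⟩ := hL.linearlyRecurrent
  -- The difference `f (n + 1) - k * f n` involves two consecutive values, so `d` zeros of it need a
  -- gap of length `d + 1`.
  obtain ⟨m, hm⟩ := hgap (d + 1)
  have hsum : ∀ n, (countWords L n : ℤ) + countWords Lᶜ n = (Fintype.card α : ℤ) ^ n :=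
    fun n => by exact_mod_cast countWords_add_countWords_compl L n
  have hz := (hd.sub_mul_shift (Fintype.card α)).eq_zero (m := m) fun i hi => by
    have h0 := hsum (m + i)
    have h1 := hsum (m + (i + 1))
    rw [hm i (by omega)] at h0
    rw [hm (i + 1) (by omega), ← add_assoc] at h1
    push_cast at h0 h1
    rw [zero_add] at h0 h1
    simp only [h0, h1]
    ring
  refine ⟨m, fun n => ?_⟩
  induction n with
  | zero => exact hm 0 (by omega)
  | succ n ih =>
    have h0 := hsum (m + n)
    have h1 := hsum (m + n + 1)
    have h2 := hz n
    rw [ih] at h0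
    push_cast at h0
    rw [zero_add] at h0
    simp only [h0] at h2
    rw [pow_succ] at h1
    have : (countWords L (m + n + 1) : ℤ) = 0 := by linarith
    exact_mod_cast this

/-- Every left quotient is a subset of the finite set of suffixes of words in `L`, so there are
finitely many of them (Myhill-Nerode). -/
theorem Language.isRegular_of_finite {α : Type} {L : Language α}
    (hL : Set.Finite (L : Set (List α))) :
    L.IsRegular := by
  refine Language.IsRegular.of_finite_range_leftQuotient ?_
  have hS : Set.Finite (⋃ w ∈ (L : Set (List α)), {y : List α | y <:+ w}) :=
    hL.biUnion fun w _ => (List.finite_toSet w.tails).subset fun y hy => by simpa using hy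
  refine hS.powerset.subset ?_
  rintro _ ⟨x, rfl⟩ y hy
  exact Set.mem_biUnion (x := x ++ y) hy ⟨x, rfl⟩

theorem Language.IsRegular.countingRegular {α : Type} [Finite α] {L : Language α}
    (hL : L.IsRegular) : CountingRegular L :=
  ⟨α, inferInstance, L, hL, fun _ => rfl⟩

/-! Rule systems: vectors of natural numbers rewritten by piecewise affine rules. -/

/-- A finite set `R` of rules that act on a control state in `Q` and a vector of natural numbers
indexed by `K`. The rule `r` may be used in the state `q` if `ok q r` and if each entry has the form
`inMul r k * y + inAdd r k`, which is then replaced by `outMul r k * y + outAdd r k`. Initially the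
entry at `input` is arbitrary and all others are zero. -/
structure RuleSystem (Q R K : Type) where
  start : Q
  input : K
  ok : Q → R → Prop
  dst : R → Q
  inMul : R → K → ℕ
  inAdd : R → K → ℕ
  outMul : R → K → ℕ
  outAdd : R → K → ℕ
  inMul_pos : ∀ r k, 0 < inMul r k
  outMul_pos : ∀ r k, 0 < outMul r k
  bound : ℕ
  in_le : ∀ r k, inMul r k + inAdd r k ≤ bound
  out_le : ∀ r k, outMul r k + outAdd r k ≤ bound

namespace RuleSystem

variable {Q R K : Type} (G : RuleSystem Q R K)

/-- Truncated subtraction and rounded division matter only for entries not of the form required by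
`r`, which `Applicable` excludes. -/
def quotient (r : R) (x : K → ℕ) (k : K) : ℕ := (x k - G.inAdd r k) / G.inMul r k

def Applicable (r : R) (x : K → ℕ) : Prop :=
  ∀ k, x k = G.inMul r k * G.quotient r x k + G.inAdd r k

def fire (r : R) (x : K → ℕ) (k : K) : ℕ := G.outMul r k * G.quotient r x k + G.outAdd r k

theorem eq_map_inr_or_exists (w : List (R ⊕ K)) :
    (∃ u : List K, w = u.map Sum.inr) ∨ ∃ (u : List K) (r : R) (w' : List (R ⊕ K)),
      w = u.map Sum.inr ++ Sum.inl r :: w' := by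
  induction w with
  | nil => exact .inl ⟨[], rfl⟩
  | cons a w ih =>
    rcases a with r | k
    · exact .inr ⟨[], r, w, rfl⟩
    · rcases ih with ⟨u, rfl⟩ | ⟨u, r, w', rfl⟩
      · exact .inl ⟨k :: u, rfl⟩
      · exact .inr ⟨k :: u, r, w', rfl⟩

theorem map_inr_append_inj {u u' : List K} {r r' : R} {w w' : List (R ⊕ K)}
    (h : u.map Sum.inr ++ Sum.inl r :: w = u'.map Sum.inr ++ Sum.inl r' :: w') :
    u = u' ∧ r = r' ∧ w = w' := by
  induction u generalizing u' with
  | nil => cases u' <;> simp_all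
  | cons k u ih =>
    cases u' with
    | nil => simp at h
    | cons k' u' =>
      simp only [List.map_cons, List.cons_append, List.cons.injEq, Sum.inr.injEq] at h
      obtain ⟨h1, h2⟩ := ih h.2
      exact ⟨by rw [h.1, h1], h2⟩

theorem exists_quotient_iff {G : RuleSystem Q R K} {r : R} {x : K → ℕ} {k : K} {y : ℕ} :
    x k = G.inMul r k * y + G.inAdd r k ↔
      x k = G.inMul r k * G.quotient r x k + G.inAdd r k ∧ y = G.quotient r x k := by
  constructor
  · intro h
    have : y = G.quotient r x k := by
      rw [quotient, h, Nat.add_sub_cancel, Nat.mul_div_cancel_left _ (G.inMul_pos r k)]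
    exact ⟨by rw [← this]; exact h, this⟩
  · rintro ⟨h, rfl⟩
    exact h

variable [DecidableEq K]

/-- The multiplicity of every element. -/
def counts (u : List K) (k : K) : ℕ := u.count k

/-- The histories that start in the state `q` with the vector `x`. Each rule is preceded by the
entries of the vector in unary, in any order. -/
inductive History : Q → (K → ℕ) → List (R ⊕ K) → Prop
  | nil (q : Q) (x : K → ℕ) : History q x []
  | cons (q : Q) (x : K → ℕ) (u : List K) (r : R) (w : List (R ⊕ K)) :
      counts u = x → G.ok q r → G.Applicable r x → History (G.dst r) (G.fire r x) w →
      History q x (u.map Sum.inr ++ Sum.inl r :: w)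

/-- The control states of a counter machine that looks for errors in histories. In the states
`up` it computes the quotient of one entry, in the states `down` it compares an entry with its
expected value. -/
inductive Control (Q R K : Type) (B : ℕ) : Type
  | start : Control Q R K B
  | reject : Control Q R K B
  | head : Q → Control Q R K B
  | mid : Q → Control Q R K B
  | up : R → K → Fin B → Control Q R K B
  | down : R → K → Fin B → Control Q R K B

instance (B : ℕ) [Finite Q] [Finite R] [Finite K] : Finite (Control Q R K B) := by
  let f : Control Q R K B → (Bool ⊕ Bool × Q) ⊕ Bool × R × K × Fin B
    | .start => .inl (.inl true)
    | .reject => .inl (.inl false)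
    | .head q => .inl (.inr (true, q))
    | .mid q => .inl (.inr (false, q))
    | .up r k i => .inr (true, r, k, i)
    | .down r k i => .inr (false, r, k, i)
  refine Finite.of_injective f fun a b h => ?_
  cases a <;> cases b <;> simp_all [f]

/-- The moves in a control state `s` other than `start` on reading `a`; the counter is zero if
`z = true`. -/
def baseMove (s : Control Q R K G.bound) (a : R ⊕ K) (z : Bool) (o : CounterOp)
    (t : Control Q R K G.bound) : Prop :=
  match s, a with
  | .start, _ => False
  | .reject, _ => o = .keep ∧ t = .reject
  | .head q, .inl r => o = .keep ∧
      ((¬ G.ok q r ∧ t = .reject) ∨ (G.ok q r ∧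
        (t = .head (G.dst r) ∨ ∃ r' k, ∃ i : Fin G.bound, (i : ℕ) = 0 ∧ t = .up r' k i)))
  | .mid q, .inl r => o = .keep ∧
      ((¬ G.ok q r ∧ t = .reject) ∨ (G.ok q r ∧
        (t = .head (G.dst r) ∨ ∃ r' k, ∃ i : Fin G.bound, (i : ℕ) = 0 ∧ t = .up r' k i)))
  | .head q, .inr _ => o = .keep ∧ t = .mid q
  | .mid q, .inr _ => o = .keep ∧ t = .mid q
  | .up r k i, .inl r' => o = .keep ∧ r' = r ∧
      (((i : ℕ) = G.inAdd r k ∧ ∃ j : Fin G.bound, (j : ℕ) = 0 ∧ t = .down r k j) ∨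
        ((i : ℕ) ≠ G.inAdd r k ∧ t = .reject))
  | .up r k i, .inr k' =>
      (k' ≠ k ∧ o = .keep ∧ t = .up r k i) ∨
      (k' = k ∧ (i : ℕ) + 1 < G.inMul r k + G.inAdd r k ∧ o = .keep ∧
        ∃ j : Fin G.bound, (j : ℕ) = i + 1 ∧ t = .up r k j) ∨
      (k' = k ∧ (i : ℕ) + 1 = G.inMul r k + G.inAdd r k ∧ o = .inc ∧
        ∃ j : Fin G.bound, (j : ℕ) = G.inAdd r k ∧ t = .up r k j)
  | .down r k i, .inl _ => o = .keep ∧ t = .reject ∧ ¬ ((i : ℕ) = G.outAdd r k ∧ z = true)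
  | .down r k i, .inr k' =>
      (k' ≠ k ∧ o = .keep ∧ t = .down r k i) ∨
      (k' = k ∧ (i : ℕ) = G.outAdd r k ∧ z = true ∧ o = .keep ∧ t = .reject) ∨
      (k' = k ∧ ¬ ((i : ℕ) = G.outAdd r k ∧ z = true) ∧
        (i : ℕ) + 1 < G.outMul r k + G.outAdd r k ∧ o = .keep ∧
        ∃ j : Fin G.bound, (j : ℕ) = i + 1 ∧ t = .down r k j) ∨
      (k' = k ∧ ¬ ((i : ℕ) = G.outAdd r k ∧ z = true) ∧
        (i : ℕ) + 1 = G.outMul r k + G.outAdd r k ∧ o = .dec ∧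
        ∃ j : Fin G.bound, (j : ℕ) = G.outAdd r k ∧ t = .down r k j)

/-- All moves that do not depend on the input. -/
def controlMove (s : Control Q R K G.bound) (a : R ⊕ K) (z : Bool) (o : CounterOp)
    (t : Control Q R K G.bound) : Prop :=
  G.baseMove s a z o t ∨ (s = .start ∧ (G.baseMove (.head G.start) a z o t ∨
    ∃ r k, ∃ i : Fin G.bound, (i : ℕ) = 0 ∧ G.baseMove (.up r k i) a z o t))

/-- The states of the machine. In the state `Sum.inr j` it expects exactly `j` more letters
`G.input` in the first vector of the history. -/
abbrev State : Type := Control Q R K G.bound ⊕ ℕ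

/-- The value `none` means that the first vector is correct: the guess that it is wrong fails and
the branch dies. -/
def chainNext : ℕ → R ⊕ K → Option G.State
  | 0, .inl _ => none
  | _ + 1, .inl _ => some (.inl .reject)
  | 0, .inr _ => some (.inl .reject)
  | j + 1, .inr k => some (if k = G.input then .inr j else .inl .reject)

/-- A real-time machine cannot guess silently, so `start` has the first moves of all the states
among which it would choose. The counter is still zero along the chain, so its moves are needed for
`z = true` only. -/
def move (N : ℕ) (s : G.State) (a : R ⊕ K) (z : Bool) (o : CounterOp) (t : G.State) : Prop :=
  (∃ s' t', s = .inl s' ∧ t = .inl t' ∧ G.controlMove s' a z o t') ∨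
  (s = .inl .start ∧ z = true ∧ o = .keep ∧ G.chainNext N a = some t) ∨
  (∃ j ≤ N, s = .inr j ∧ z = true ∧ o = .keep ∧ G.chainNext j a = some t)

/-- The state `reject` is the accepting sink, entered when an error is confirmed. A word that stops
inside a vector is no history, hence `mid` is final; a history may stop right after a rule, hence
`head` is not. A check that is still open when the word ends has found no error. -/
def Final : G.State → Prop
  | .inl .reject => True
  | .inl (.mid _) => True
  | _ => False

def Accepts (N : ℕ) : G.State → ℕ → List (R ⊕ K) → Prop
  | s, _, [] => G.Final s
  | s, c, a :: w => ∃ o t c', G.move N s a (decide (c = 0)) o t ∧ o.apply c = some c' ∧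
      Accepts N t c' w

/-! ### Acceptance from each kind of control state, and correctness of the search for errors. -/

variable {G} {N : ℕ}

theorem accepts_reject (c : ℕ) (w : List (R ⊕ K)) : G.Accepts N (.inl .reject) c w := by
  induction w with
  | nil => trivial
  | cons a w ih =>
    exact ⟨.keep, .inl .reject, c, .inl ⟨.reject, .reject, rfl, rfl, .inl ⟨rfl, rfl⟩⟩, rfl, ih⟩

theorem accepts_control_cons {s : Control Q R K G.bound} (hs : s ≠ .start) (c : ℕ) (a : R ⊕ K)
    (w : List (R ⊕ K)) : G.Accepts N (.inl s) c (a :: w) ↔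
      ∃ o t c', G.baseMove s a (decide (c = 0)) o t ∧ o.apply c = some c' ∧
        G.Accepts N (.inl t) c' w := by
  constructor
  · rintro ⟨o, t, c', h, ho, hw⟩
    rcases h with ⟨s', t', hs', rfl, h⟩ | ⟨h, _⟩ | ⟨j, _, h, _⟩
    · cases hs'
      rcases h with h | ⟨h, _⟩
      · exact ⟨o, t', c', h, ho, hw⟩
      · exact absurd h hs
    · cases h
      exact absurd rfl hs
    · cases h
  · rintro ⟨o, t, c', h, ho, hw⟩
    exact ⟨o, .inl t, c', .inl ⟨s, t, rfl, rfl, .inl h⟩, ho, hw⟩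

theorem accepts_chain_cons {j : ℕ} (hj : j ≤ N) (a : R ⊕ K) (w : List (R ⊕ K)) :
    G.Accepts N (.inr j) 0 (a :: w) ↔ ∃ t, G.chainNext j a = some t ∧ G.Accepts N t 0 w := by
  constructor
  · rintro ⟨o, t, c', h, ho, hw⟩
    rcases h with ⟨s', t', hs', rfl, h⟩ | ⟨h, _⟩ | ⟨j', _, h, _, rfl, h'⟩
    · cases hs'
    · cases h
    · cases h
      cases ho
      exact ⟨t, h', hw⟩
  · rintro ⟨t, h, hw⟩
    exact ⟨.keep, t, 0, .inr (.inr ⟨j, hj, rfl, rfl, rfl, h⟩), rfl, hw⟩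

theorem accepts_start (w : List (R ⊕ K)) : G.Accepts N (.inl .start) 0 w ↔
    (G.Accepts N (.inl (.head G.start)) 0 w ∨
      ∃ r k, ∃ i : Fin G.bound, (i : ℕ) = 0 ∧ G.Accepts N (.inl (.up r k i)) 0 w) ∨
        G.Accepts N (.inr N) 0 w := by
  cases w with
  | nil => simp [Accepts, Final]
  | cons a w =>
    simp only [accepts_control_cons (G := G) (N := N) (s := .head G.start) (by simp),
      accepts_control_cons (G := G) (N := N) (s := .up _ _ _) (by simp),
      accepts_chain_cons le_rfl]
    constructor
    · rintro ⟨o, t, c', h, ho, hw⟩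
      rcases h with ⟨s', t', hs', rfl, h⟩ | ⟨_, _, rfl, h⟩ | ⟨j, _, h, _⟩
      · cases hs'
        rcases h with h | ⟨_, h | ⟨r, k, i, hi, h⟩⟩
        · exact h.elim
        · exact .inl (.inl ⟨o, t', c', h, ho, hw⟩)
        · exact .inl (.inr ⟨r, k, i, hi, o, t', c', h, ho, hw⟩)
      · cases ho
        exact .inr ⟨t, h, hw⟩
      · cases h
    · rintro ((⟨o, t, c', h, ho, hw⟩ | ⟨r, k, i, hi, o, t, c', h, ho, hw⟩) | ⟨t, h, hw⟩)
      · exact ⟨o, .inl t, c', .inl ⟨_, t, rfl, rfl, .inr ⟨rfl, .inl h⟩⟩, ho, hw⟩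
      · exact ⟨o, .inl t, c', .inl ⟨_, t, rfl, rfl, .inr ⟨rfl, .inr ⟨r, k, i, hi, h⟩⟩⟩, ho, hw⟩
      · exact ⟨.keep, t, 0, .inr (.inl ⟨rfl, by simp, rfl, h⟩), rfl, hw⟩

theorem accepts_chain {j : ℕ} (hj : j ≤ N) (u : List K) (r : R) (w : List (R ⊕ K)) :
    G.Accepts N (.inr j) 0 (u.map Sum.inr ++ Sum.inl r :: w) ↔
      counts u ≠ Pi.single G.input j := by
  induction u generalizing j with
  | nil =>
    simp only [List.map_nil, List.nil_append, accepts_chain_cons hj]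
    have h0 : counts ([] : List K) = 0 := by ext; simp [counts]
    cases j with
    | zero => simp [chainNext, h0]
    | succ j =>
      simp [chainNext, h0, accepts_reject, funext_iff, Pi.single_apply]
  | cons k u ih =>
    simp only [List.map_cons, List.cons_append, accepts_chain_cons hj]
    cases j with
    | zero =>
      simp only [chainNext, Option.some.injEq, exists_eq_left', accepts_reject, true_iff]
      intro h
      have := congrFun h k
      simp [counts] at this
    | succ j =>
      simp only [chainNext, Option.some.injEq, exists_eq_left']
      split_ifs with hk
      · rw [ih (by omega)]
        refine not_congr ?_
        rw [funext_iff, funext_iff]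
        refine forall_congr' fun k' => ?_
        simp only [counts, List.count_cons, Pi.single_apply, hk, beq_iff_eq, eq_comm (a := k')]
        split_ifs <;> omega
      · simp only [accepts_reject, true_iff]
        intro h
        have := congrFun h k
        simp [counts, hk] at this

/-- In this state `outMul r k * c + outAdd r k - i` further letters `k` are expected; `hi` and `hc`
make this nonnegative. Whenever `i` would reach `outMul r k + outAdd r k`, it falls back to `outAdd
r k` and one unit of the counter pays for the `outMul r k` letters. -/
theorem accepts_down (r : R) (k : K) (i : Fin G.bound) (c : ℕ) (u : List K) (r' : R)
    (w : List (R ⊕ K)) (hi : (i : ℕ) < G.outMul r k + G.outAdd r k)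
    (hc : c = 0 → (i : ℕ) ≤ G.outAdd r k) :
    G.Accepts N (.inl (.down r k i)) c (u.map Sum.inr ++ Sum.inl r' :: w) ↔
      u.count k + i ≠ G.outMul r k * c + G.outAdd r k := by
  have hpos := G.outMul_pos r k
  induction u generalizing i c with
  | nil =>
    simp only [List.map_nil, List.nil_append]
    rw [accepts_control_cons (by simp)]
    simp only [baseMove]
    have key : ((i : ℕ) = G.outAdd r k ∧ c = 0) ↔
        (i : ℕ) = G.outMul r k * c + G.outAdd r k := by
      constructor
      · rintro ⟨h, rfl⟩; simpa using h
      · intro h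
        rcases Nat.eq_zero_or_pos c with rfl | hc'
        · simpa using h
        · have := Nat.mul_le_mul_left (G.outMul r k) hc'
          omega
    simp only [List.count_nil, zero_add, ne_eq, ← key, decide_eq_true_eq]
    constructor
    · rintro ⟨o, t, c', ⟨_, _, h⟩, _⟩
      exact h
    · intro h
      exact ⟨_, _, c, ⟨rfl, rfl, h⟩, rfl, accepts_reject _ _⟩
  | cons k' u ih =>
    simp only [List.map_cons, List.cons_append]
    rw [accepts_control_cons (by simp)]
    simp only [baseMove, decide_eq_true_eq]
    by_cases hk : k' = k
    swap
    · have hcount : (k' :: u).count k = u.count k := List.count_cons_of_ne hk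
      rw [hcount]
      refine Iff.trans ?_ (ih i c hi hc)
      constructor
      · rintro ⟨o, t, c', h, ho, hw⟩
        rcases h with ⟨_, rfl, rfl⟩ | ⟨h, _⟩ | ⟨h, _⟩ | ⟨h, _⟩
        · cases ho; exact hw
        all_goals exact absurd h hk
      · intro h
        exact ⟨_, _, c, .inl ⟨hk, rfl, rfl⟩, rfl, h⟩
    subst hk
    have hcount : (k' :: u).count k' = u.count k' + 1 := List.count_cons_self
    rw [hcount]
    by_cases hz : (i : ℕ) = G.outAdd r k' ∧ c = 0
    · obtain ⟨h1, rfl⟩ := hz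
      refine iff_of_true ⟨_, _, 0, .inr (.inl ⟨rfl, h1, rfl, rfl, rfl⟩), rfl,
        accepts_reject _ _⟩ (by omega)
    have hc0 : G.outAdd r k' ≤ i → 0 < c := by omega
    by_cases hlt : (i : ℕ) + 1 < G.outMul r k' + G.outAdd r k'
    · have hb := G.out_le r k'
      have hrec := ih ⟨i + 1, by omega⟩ c hlt (fun h => by show (i : ℕ) + 1 ≤ _; omega)
      simp only at hrec
      rw [show List.count k' u + 1 + (i : ℕ) = List.count k' u + (i + 1) by omega]
      refine Iff.trans ?_ hrec
      constructor
      · rintro ⟨o, t, c', h, ho, hw⟩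
        rcases h with ⟨h, _⟩ | ⟨_, h1, h2, _⟩ | ⟨_, _, _, rfl, j, hj, rfl⟩ | ⟨_, _, h, _⟩
        · exact absurd rfl h
        · exact absurd ⟨h1, h2⟩ hz
        · cases ho
          rwa [show j = ⟨i + 1, by omega⟩ from Fin.ext hj] at hw
        · omega
      · intro h
        exact ⟨_, _, c, .inr (.inr (.inl ⟨rfl, hz, hlt, rfl, _, rfl, rfl⟩)), rfl, h⟩
    · have hb := G.out_le r k'
      obtain ⟨d, rfl⟩ : ∃ d, c = d + 1 := ⟨c - 1, by omega⟩
      have hrec := ih ⟨G.outAdd r k', by omega⟩ d (by show G.outAdd r k' < _; omega)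
        (fun h => le_rfl)
      simp only at hrec
      have : (List.count k' u + 1 + (i : ℕ) ≠ G.outMul r k' * (d + 1) + G.outAdd r k') ↔
          (List.count k' u + G.outAdd r k' ≠ G.outMul r k' * d + G.outAdd r k') := by
        rw [mul_add]; omega
      rw [this]
      refine Iff.trans ?_ hrec
      constructor
      · rintro ⟨o, t, c', h, ho, hw⟩
        rcases h with ⟨h, _⟩ | ⟨_, h1, h2, _⟩ | ⟨_, _, h, _⟩ | ⟨_, _, _, rfl, j, hj, rfl⟩
        · exact absurd rfl h
        · omega
        · omega
        · cases ho
          rwa [show j = ⟨G.outAdd r k', by omega⟩ from Fin.ext hj] at hw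
      · intro h
        exact ⟨_, _, d, .inr (.inr (.inr ⟨rfl, hz, by omega, rfl, _, rfl, rfl⟩)), rfl, h⟩

/-- So far `i + inMul r k * c` letters `k` have been read: beyond the first `inAdd r k`, every
`inMul r k` letters become one unit of the counter. By `hi` and `hc`, at the end of the vector the
total has the form required by `r` exactly if `i = inAdd r k`, and then the quotient is `c`.
Otherwise the machine accepts, and the condition on `y` is vacuous. The rule follows the vector, so
`r` is a guess that `r'` must confirm. -/
theorem accepts_up (r : R) (k : K) (i : Fin G.bound) (c : ℕ) (u : List K) (r' : R)
    (w : List (R ⊕ K)) (hi : (i : ℕ) < G.inMul r k + G.inAdd r k)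
    (hc : (i : ℕ) < G.inAdd r k → c = 0) :
    G.Accepts N (.inl (.up r k i)) c (u.map Sum.inr ++ Sum.inl r' :: w) ↔
      r' = r ∧ ∀ y, u.count k + i + G.inMul r k * c = G.inMul r k * y + G.inAdd r k →
        ∃ j : Fin G.bound, (j : ℕ) = 0 ∧ G.Accepts N (.inl (.down r k j)) y w := by
  have hpos := G.inMul_pos r k
  induction u generalizing i c with
  | nil =>
    simp only [List.map_nil, List.nil_append]
    rw [accepts_control_cons (by simp)]
    simp only [baseMove, List.count_nil, zero_add]
    by_cases h : (i : ℕ) = G.inAdd r k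
    · have hy : ∀ y, (i + G.inMul r k * c = G.inMul r k * y + G.inAdd r k) ↔ y = c := fun y => by
        rw [h, add_comm]
        constructor
        · intro h; exact (Nat.eq_of_mul_eq_mul_left hpos (by omega)).symm
        · rintro rfl; rfl
      simp only [hy, forall_eq]
      constructor
      · rintro ⟨o, t, c', ⟨rfl, h1, ⟨_, j, hj, rfl⟩ | ⟨h', _⟩⟩, ho, hw⟩
        · cases ho
          exact ⟨h1, j, hj, hw⟩
        · exact absurd h h'
      · rintro ⟨h1, j, hj, hw⟩
        exact ⟨_, _, c, ⟨rfl, h1, .inl ⟨h, j, hj, rfl⟩⟩, rfl, hw⟩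
    · have hy : ∀ y, ¬ (i + G.inMul r k * c = G.inMul r k * y + G.inAdd r k) := fun y hy => by
        rcases lt_or_gt_of_ne h with h1 | h1
        · rw [hc h1] at hy
          omega
        · rcases le_or_gt y c with h2 | h2
          · have := Nat.mul_le_mul_left (G.inMul r k) h2
            omega
          · have := Nat.mul_le_mul_left (G.inMul r k) h2
            rw [Nat.succ_eq_add_one, mul_add] at this
            omega
      simp only [hy, false_imp_iff, implies_true, and_true]
      constructor
      · rintro ⟨o, t, c', ⟨_, h1, _⟩, _⟩
        exact h1
      · intro h1
        exact ⟨_, _, c, ⟨rfl, h1, .inr ⟨h, rfl⟩⟩, rfl, accepts_reject _ _⟩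
  | cons k' u ih =>
    simp only [List.map_cons, List.cons_append]
    rw [accepts_control_cons (by simp)]
    simp only [baseMove]
    by_cases hk : k' = k
    swap
    · have hcount : (k' :: u).count k = u.count k := List.count_cons_of_ne hk
      rw [hcount]
      refine Iff.trans ?_ (ih i c hi hc)
      constructor
      · rintro ⟨o, t, c', h, ho, hw⟩
        rcases h with ⟨_, rfl, rfl⟩ | ⟨h, _⟩ | ⟨h, _⟩
        · cases ho; exact hw
        all_goals exact absurd h hk
      · intro h
        exact ⟨_, _, c, .inl ⟨hk, rfl, rfl⟩, rfl, h⟩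
    subst hk
    have hcount : (k' :: u).count k' = u.count k' + 1 := List.count_cons_self
    rw [hcount]
    have hb := G.in_le r k'
    by_cases hlt : (i : ℕ) + 1 < G.inMul r k' + G.inAdd r k'
    · have hrec := ih ⟨i + 1, by omega⟩ c hlt (fun h => hc (by simp only at h; omega))
      simp only at hrec
      rw [show List.count k' u + 1 + (i : ℕ) = List.count k' u + (i + 1) by omega]
      refine Iff.trans ?_ hrec
      constructor
      · rintro ⟨o, t, c', h, ho, hw⟩
        rcases h with ⟨h, _⟩ | ⟨_, _, rfl, j, hj, rfl⟩ | ⟨_, h, _⟩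
        · exact absurd rfl h
        · cases ho
          rwa [show j = ⟨i + 1, by omega⟩ from Fin.ext hj] at hw
        · omega
      · intro h
        exact ⟨_, _, c, .inr (.inl ⟨rfl, hlt, rfl, _, rfl, rfl⟩), rfl, h⟩
    · have hrec := ih ⟨G.inAdd r k', by omega⟩ (c + 1) (by show G.inAdd r k' < _; omega)
        (fun h => absurd h (lt_irrefl _))
      simp only at hrec
      rw [show List.count k' u + 1 + (i : ℕ) + G.inMul r k' * c =
        List.count k' u + G.inAdd r k' + G.inMul r k' * (c + 1) by rw [mul_add]; omega]
      refine Iff.trans ?_ hrec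
      constructor
      · rintro ⟨o, t, c', h, ho, hw⟩
        rcases h with ⟨h, _⟩ | ⟨_, h, _⟩ | ⟨_, _, rfl, j, hj, rfl⟩
        · exact absurd rfl h
        · omega
        · cases ho
          rwa [show j = ⟨G.inAdd r k', by omega⟩ from Fin.ext hj] at hw
      · intro h
        exact ⟨_, _, c + 1, .inr (.inr ⟨rfl, by omega, rfl, _, rfl, rfl⟩), rfl, h⟩

/-- Acceptance from the states entered at the beginning of a vector. -/
def AcceptsFrom (G : RuleSystem Q R K) (N : ℕ) (q : Q) (w : List (R ⊕ K)) : Prop :=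
  G.Accepts N (.inl (.head q)) 0 w ∨
    ∃ r k, ∃ i : Fin G.bound, (i : ℕ) = 0 ∧ G.Accepts N (.inl (.up r k i)) 0 w

theorem accepts_mid_cons (q : Q) (r : R) (w : List (R ⊕ K)) :
    G.Accepts N (.inl (.mid q)) 0 (Sum.inl r :: w) ↔ ¬ G.ok q r ∨ G.AcceptsFrom N (G.dst r) w := by
  rw [accepts_control_cons (by simp)]
  simp only [baseMove]
  constructor
  · rintro ⟨o, t, c', ⟨rfl, ⟨h, _⟩ | ⟨_, rfl | ⟨r', k, i, hi, rfl⟩⟩⟩, ho, hw⟩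
    · exact .inl h
    · cases ho; exact .inr (.inl hw)
    · cases ho; exact .inr (.inr ⟨r', k, i, hi, hw⟩)
  · intro h
    by_cases hok : G.ok q r
    · rcases h.resolve_left (not_not_intro hok) with h | ⟨r', k, i, hi, h⟩
      · exact ⟨_, _, 0, ⟨rfl, .inr ⟨hok, .inl rfl⟩⟩, rfl, h⟩
      · exact ⟨_, _, 0, ⟨rfl, .inr ⟨hok, .inr ⟨r', k, i, hi, rfl⟩⟩⟩, rfl, h⟩
    · exact ⟨_, _, 0, ⟨rfl, .inl ⟨hok, rfl⟩⟩, rfl, accepts_reject _ _⟩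

theorem accepts_at_cons (q : Q) (r : R) (w : List (R ⊕ K)) :
    G.Accepts N (.inl (.head q)) 0 (Sum.inl r :: w) ↔ ¬ G.ok q r ∨ G.AcceptsFrom N (G.dst r) w := by
  rw [← accepts_mid_cons, accepts_control_cons (by simp), accepts_control_cons (by simp)]
  simp only [baseMove]

theorem accepts_mid_inr (q : Q) (u : List K) (w : List (R ⊕ K)) :
    G.Accepts N (.inl (.mid q)) 0 (u.map Sum.inr ++ w) ↔ G.Accepts N (.inl (.mid q)) 0 w := by
  induction u with
  | nil => rfl
  | cons k u ih =>
    rw [← ih, List.map_cons, List.cons_append, accepts_control_cons (by simp)]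
    simp only [baseMove]
    constructor
    · rintro ⟨o, t, c', ⟨rfl, rfl⟩, ho, hw⟩
      cases ho; exact hw
    · intro h
      exact ⟨_, _, 0, ⟨rfl, rfl⟩, rfl, h⟩

theorem accepts_at_inr (q : Q) (k : K) (w : List (R ⊕ K)) :
    G.Accepts N (.inl (.head q)) 0 (Sum.inr k :: w) ↔ G.Accepts N (.inl (.mid q)) 0 w := by
  rw [accepts_control_cons (by simp)]
  simp only [baseMove]
  constructor
  · rintro ⟨o, t, c', ⟨rfl, rfl⟩, ho, hw⟩
    cases ho; exact hw
  · intro h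
    exact ⟨_, _, 0, ⟨rfl, rfl⟩, rfl, h⟩

theorem accepts_at (q : Q) (u : List K) (r : R) (w : List (R ⊕ K)) :
    G.Accepts N (.inl (.head q)) 0 (u.map Sum.inr ++ Sum.inl r :: w) ↔
      ¬ G.ok q r ∨ G.AcceptsFrom N (G.dst r) w := by
  cases u with
  | nil => exact accepts_at_cons q r w
  | cons k u =>
    rw [List.map_cons, List.cons_append, accepts_at_inr, accepts_mid_inr, accepts_mid_cons]

theorem history_cons_iff {q : Q} {x : K → ℕ} {u : List K} {r : R} {w : List (R ⊕ K)} :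
    G.History q x (u.map Sum.inr ++ Sum.inl r :: w) ↔
      counts u = x ∧ G.ok q r ∧ G.Applicable r x ∧ G.History (G.dst r) (G.fire r x) w := by
  constructor
  · intro h
    generalize hv : u.map Sum.inr ++ Sum.inl r :: w = v at h
    cases h with
    | nil => simp at hv
    | cons _ _ u' r' w' h1 h2 h3 h4 =>
      obtain ⟨rfl, rfl, rfl⟩ := map_inr_append_inj hv
      exact ⟨h1, h2, h3, h4⟩
  · rintro ⟨h1, h2, h3, h4⟩
    exact .cons _ _ _ _ _ h1 h2 h3 h4

theorem not_history_map_inr {q : Q} {x : K → ℕ} {u : List K} (hu : u ≠ []) :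
    ¬ G.History q x (u.map Sum.inr) := by
  intro h
  generalize hv : u.map Sum.inr = v at h
  cases h with
  | nil => exact hu (by simpa using hv)
  | cons _ _ u' r w =>
    have : (Sum.inl r : R ⊕ K) ∈ u.map Sum.inr := by rw [hv]; simp
    simp at this

/-- Here `E` is the check of the coming vector that is already under way: the chain for the first
vector, a comparison in a state `down` for a later one. If that vector is correct, `E` finds
nothing, and any error lies in the next rule, in its effect on some entry, or further on; this gives
an induction on the length. -/
theorem history_iff_not_accepts (w : List (R ⊕ K)) (q : Q) (x : K → ℕ) (E : List (R ⊕ K) → Prop)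
    (h0 : ¬ E []) (h1 : ∀ u r w', E (u.map Sum.inr ++ Sum.inl r :: w') ↔ counts u ≠ x) :
    G.History q x w ↔ ¬ (G.AcceptsFrom N q w ∨ E w) := by
  induction hn : w.length using Nat.strong_induction_on generalizing w q x E with
  | _ n ih =>
    rcases eq_map_inr_or_exists w with ⟨u, rfl⟩ | ⟨u, r, w', rfl⟩
    · cases u with
      | nil => simp [History.nil, AcceptsFrom, Accepts, Final, h0]
      | cons k u =>
        -- The word ends inside a vector, which the final state `mid` detects.
        refine iff_of_false (not_history_map_inr (by simp)) (not_not_intro (.inl (.inl ?_)))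
        rw [List.map_cons, accepts_at_inr, ← List.append_nil (u.map Sum.inr), accepts_mid_inr]
        trivial
    · rw [history_cons_iff, h1]
      by_cases hx : counts u = x
      swap
      · simp [hx]
      rw [AcceptsFrom, accepts_at]
      -- Only the correct guess `r' = r` survives. An entry that is not of the form required by `r`
      -- leads to acceptance at once, which is the vacuous case of the implication.
      have hup : (∃ r' k, ∃ i : Fin G.bound, (i : ℕ) = 0 ∧
          G.Accepts N (.inl (.up r' k i)) 0 (u.map Sum.inr ++ Sum.inl r :: w')) ↔
          ∃ k, x k = G.inMul r k * G.quotient r x k + G.inAdd r k →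
            ∃ j : Fin G.bound, (j : ℕ) = 0 ∧ G.Accepts N (.inl (.down r k j)) (G.quotient r x k) w' := by
        have hpos := fun r k => G.inMul_pos r k
        have hxk : ∀ k, u.count k = x k := congrFun hx
        constructor
        · rintro ⟨r', k, i, hi, h⟩
          rw [accepts_up _ _ _ _ _ _ _ (by have := hpos r' k; omega) (fun _ => rfl)] at h
          obtain ⟨rfl, h⟩ := h
          refine ⟨k, fun hk => h _ ?_⟩
          rw [hi, mul_zero, add_zero, add_zero, hxk]
          exact hk
        · rintro ⟨k, h⟩
          have hb := G.in_le r k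
          refine ⟨r, k, ⟨0, by have := hpos r k; omega⟩, rfl, ?_⟩
          rw [accepts_up _ _ _ _ _ _ _ (by have := hpos r k; simp only; omega) (fun _ => rfl)]
          refine ⟨rfl, fun y hy => ?_⟩
          simp only [mul_zero, add_zero, hxk] at hy
          obtain ⟨h2, rfl⟩ := exists_quotient_iff.1 hy
          exact h h2
      rw [hup]
      by_cases happ : G.Applicable r x
      swap
      · obtain ⟨k, hk⟩ := not_forall.1 happ
        refine iff_of_false (fun h => happ h.2.2.1) (not_not_intro (.inl (.inr ⟨k, ?_⟩)))
        exact fun h => absurd h hk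
      -- The next check under way: some entry of the next vector is compared with its value in
      -- `G.fire r x`.
      have hE := ih w'.length (by rw [← hn]; simp; omega) w' (G.dst r) (G.fire r x)
        (fun v => ∃ k, ∃ j : Fin G.bound, (j : ℕ) = 0 ∧
          G.Accepts N (.inl (.down r k j)) (G.quotient r x k) v)
        (by simp [Accepts, Final]) (fun v r' w'' => ?_) rfl
      · rw [hE]
        simp only [hx, true_and, happ, ne_eq, not_true, or_false]
        have : (∃ k, x k = G.inMul r k * G.quotient r x k + G.inAdd r k →
            ∃ j : Fin G.bound, (j : ℕ) = 0 ∧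
              G.Accepts N (.inl (.down r k j)) (G.quotient r x k) w') ↔
            ∃ k, ∃ j : Fin G.bound, (j : ℕ) = 0 ∧
              G.Accepts N (.inl (.down r k j)) (G.quotient r x k) w' :=
          exists_congr fun k => ⟨fun h => h (happ k), fun h _ => h⟩
        rw [this]
        by_cases hok : G.ok q r <;>
          simp only [hok, true_and, false_and, not_true, not_false_eq_true, false_or, true_or]
      · rw [Function.ne_iff]
        refine exists_congr fun k => ?_
        have hpos := G.outMul_pos r k
        have hb := G.out_le r k
        constructor
        · rintro ⟨j, hj, h⟩
          rw [accepts_down _ _ _ _ _ _ _ (by omega) (by omega), hj] at h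
          exact h
        · intro h
          refine ⟨⟨0, by omega⟩, rfl, ?_⟩
          rw [accepts_down _ _ _ _ _ _ _ (by simp only; omega) (by simp)]
          exact h

/-- The machine accepts exactly the words that are not histories. -/
theorem accepts_start_iff (w : List (R ⊕ K)) :
    G.Accepts N (.inl .start) 0 w ↔ ¬ G.History G.start (Pi.single G.input N) w := by
  rw [history_iff_not_accepts (N := N) w G.start _ (fun w => G.Accepts N (.inr N) 0 w)
    (by simp [Accepts, Final]) (fun u r w' => accepts_chain le_rfl u r w'), not_not, accepts_start,
    AcceptsFrom]

end RuleSystem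

/-! ### Bounding the number of reversals. -/

namespace CounterOp

/-- Three consecutive blocks would be `inc, dec, inc` or `dec, inc, dec`, and both contain a `dec`
before an `inc`. -/
theorem reversals_le_one {l : List CounterOp} (h : l.Pairwise fun a b => ¬ (a = dec ∧ b = inc)) :
    reversals l ≤ 1 := by
  have hsub := (l.filter (fun o => o ≠ keep)).destutter_sublist (fun o o' => o ≠ o')
  have hchain := (l.filter (fun o => o ≠ keep)).isChain_destutter (fun o o' => o ≠ o')
  have hp := (h.filter (fun o => decide (o ≠ keep))).sublist hsub
  have hk : ∀ o ∈ (l.filter (fun o => o ≠ keep)).destutter (fun o o' => o ≠ o'), o ≠ keep :=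
    fun o ho => by simpa using (List.mem_filter.1 (hsub.subset ho)).2
  unfold reversals
  generalize (l.filter (fun o => o ≠ keep)).destutter (fun o o' => o ≠ o') = d at *
  rcases d with _ | ⟨a, _ | ⟨b, _ | ⟨c, d⟩⟩⟩
  · simp
  · simp
  · simp
  · exfalso
    simp only [List.isChain_cons_cons] at hchain
    simp only [List.pairwise_cons, List.mem_cons, forall_eq_or_imp] at hp
    simp only [List.mem_cons, forall_eq_or_imp] at hk
    obtain ⟨hab, hbc, _⟩ := hchain
    cases a <;> cases b <;> cases c <;> simp_all

end CounterOp

/-! The rule system as a one-counter machine. -/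

namespace RuleSystem

section

variable {Q R K : Type} (G : RuleSystem Q R K)

/-- The states from which the counter is never increased. -/
def Falling : G.State → Prop
  | .inl .reject => True
  | .inl (.down _ _ _) => True
  | .inr _ => True
  | _ => False

variable [DecidableEq K]

theorem move_of_falling {N : ℕ} {s : G.State} {a : R ⊕ K} {z : Bool} {o : CounterOp} {t : G.State}
    (h : G.move N s a z o t) (hs : G.Falling s) : o ≠ .inc ∧ G.Falling t := by
  rcases h with ⟨s, t, rfl, rfl, h | ⟨rfl, _⟩⟩ | ⟨rfl, _⟩ | ⟨j, _, rfl, _, rfl, h⟩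
  · cases s with
    | reject =>
      obtain ⟨rfl, rfl⟩ := h
      exact ⟨by simp, trivial⟩
    | down r k i =>
      cases a with
      | inl r' =>
        obtain ⟨rfl, rfl, _⟩ := h
        exact ⟨by simp, trivial⟩
      | inr k' =>
        rcases h with ⟨_, rfl, rfl⟩ | ⟨_, _, _, rfl, rfl⟩ | ⟨_, _, _, rfl, _, _, rfl⟩ |
          ⟨_, _, _, rfl, _, _, rfl⟩ <;> exact ⟨by simp, trivial⟩
    | _ => exact hs.elim
  · exact hs.elim
  · exact hs.elim
  · refine ⟨by simp, ?_⟩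
    cases a <;> cases j <;> simp only [chainNext, Option.some.injEq, reduceCtorEq] at h <;> subst h
    · trivial
    · trivial
    · split_ifs <;> trivial

theorem move_of_not_falling {N : ℕ} {s : G.State} {a : R ⊕ K} {z : Bool} {o : CounterOp}
    {t : G.State} (h : G.move N s a z o t) (hs : ¬ G.Falling s) : o ≠ .dec := by
  have key : ∀ s t, G.baseMove s a z o t → ¬ G.Falling (.inl s) → o ≠ .dec := by
    intro s t h hs
    cases s with
    | start => exact h.elim
    | reject => exact absurd trivial hs
    | head q => cases a <;> simp [h.1]
    | mid q => cases a <;> simp [h.1]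
    | up r k i =>
      cases a with
      | inl r' => simp [h.1]
      | inr k' =>
        rcases h with ⟨_, rfl, _⟩ | ⟨_, _, rfl, _⟩ | ⟨_, _, rfl, _⟩ <;> simp
    | down r k i => exact absurd trivial hs
  rcases h with ⟨s, t, rfl, rfl, h | ⟨rfl, h | ⟨r, k, i, _, h⟩⟩⟩ | ⟨_, _, rfl, _⟩ |
    ⟨j, _, rfl, _, rfl, h⟩
  · exact key s t h hs
  · exact key _ t h (by simp [Falling])
  · exact key _ t h (by simp [Falling])
  · simp
  · simp

end

variable {Q R K : Type} (G : RuleSystem Q R K) [Finite Q] [Finite R] [Finite K]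

noncomputable def controlEquiv : Control Q R K G.bound ≃ Fin (Nat.card (Control Q R K G.bound)) :=
  Finite.equivFin _

noncomputable def letterEquiv (_ : RuleSystem Q R K) : R ⊕ K ≃ Fin (Nat.card (R ⊕ K)) :=
  Finite.equivFin _

noncomputable def encodeState : G.State → ℕ
  | .inl s => G.controlEquiv s
  | .inr j => Nat.card (Control Q R K G.bound) + j

theorem encodeState_injective : Function.Injective G.encodeState := by
  rintro (s | j) (t | i) h
  · exact congrArg Sum.inl (G.controlEquiv.injective (Fin.ext h))
  · have := (G.controlEquiv s).isLt
    simp only [encodeState] at h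
    omega
  · have := (G.controlEquiv t).isLt
    simp only [encodeState] at h
    omega
  · simp only [encodeState] at h
    rw [show j = i by omega]

noncomputable def encodeMove (s : ℕ) (a : R ⊕ K) (z : Bool) (o : CounterOp) (t : ℕ) : CounterMove :=
  ⟨s, some (G.letterEquiv a), z, o, t⟩

/-- This list does not depend on the input `N`, so it may be chosen non-constructively and still be
a constant of a computable function. -/
theorem exists_controlMoves : ∃ l : List CounterMove, ∀ t, t ∈ l ↔
    ∃ s a z o s', G.controlMove s a z o s' ∧
      t = G.encodeMove (G.encodeState (.inl s)) a z o (G.encodeState (.inl s')) := by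
  have : Finite CounterOp := Finite.of_equiv _ CounterOp.equivFin.symm
  let f : Control Q R K G.bound × (R ⊕ K) × Bool × CounterOp × Control Q R K G.bound →
    CounterMove := fun p => G.encodeMove (G.encodeState (.inl p.1)) p.2.1 p.2.2.1 p.2.2.2.1
      (G.encodeState (.inl p.2.2.2.2))
  have hfin : (f '' {p | G.controlMove p.1 p.2.1 p.2.2.1 p.2.2.2.1 p.2.2.2.2}).Finite :=
    (Set.toFinite _).image f
  refine ⟨hfin.toFinset.toList, fun t => ?_⟩
  simp only [Finset.mem_toList, Set.Finite.mem_toFinset, Set.mem_image, Set.mem_ofPred_eq,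
    Prod.exists, f]
  simp only [eq_comm]

theorem exists_finalStates : ∃ l : List ℕ, ∀ q, q ∈ l ↔
    ∃ s : G.State, G.Final s ∧ q = G.encodeState s := by
  have hfin : ((fun s => G.encodeState (.inl s)) '' {s | G.Final (.inl s)}).Finite :=
    (Set.toFinite _).image _
  refine ⟨hfin.toFinset.toList, fun t => ?_⟩
  simp only [Finset.mem_toList, Set.Finite.mem_toFinset, Set.mem_image, Set.mem_ofPred_eq]
  constructor
  · rintro ⟨s, hs, rfl⟩
    exact ⟨_, hs, rfl⟩
  · rintro ⟨s | j, hs, rfl⟩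
    · exact ⟨s, hs, rfl⟩
    · exact hs.elim

theorem exists_letters (R K : Type) [Finite R] [Finite K] : ∃ l : List (R ⊕ K), ∀ a, a ∈ l := by
  have := Fintype.ofFinite (R ⊕ K)
  exact ⟨Finset.univ.toList, by simp⟩

variable [DecidableEq K]

noncomputable def chainMoves (s j : ℕ) : List CounterMove :=
  (exists_letters R K).choose.filterMap fun a =>
    (G.chainNext j a).map fun t => G.encodeMove s a true .keep (G.encodeState t)

/-- Only the chain moves vary with `N`; all other components are constants. -/
noncomputable def machine (N : ℕ) : OneCounterMachine where
  alphabetSize := Nat.card (R ⊕ K)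
  start := G.encodeState (.inl .start)
  final := G.exists_finalStates.choose
  moves := G.exists_controlMoves.choose ++ (G.chainMoves (G.encodeState (.inl .start)) N ++
    (List.range (N + 1)).flatMap fun j =>
      G.chainMoves (Nat.card (Control Q R K G.bound) + j) j)

theorem mem_chainMoves {s j : ℕ} {t : CounterMove} : t ∈ G.chainMoves s j ↔
    ∃ a s', G.chainNext j a = some s' ∧ t = G.encodeMove s a true .keep (G.encodeState s') := by
  simp only [chainMoves, List.mem_filterMap, (exists_letters R K).choose_spec, true_and,
    Option.map_eq_some_iff, eq_comm (a := t)]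

theorem mem_machine_moves {N : ℕ} {t : CounterMove} : t ∈ (G.machine N).moves ↔
    ∃ s a z o s', G.move N s a z o s' ∧
      t = G.encodeMove (G.encodeState s) a z o (G.encodeState s') := by
  simp only [machine, List.mem_append, G.exists_controlMoves.choose_spec, mem_chainMoves,
    List.mem_flatMap, List.mem_range, move]
  constructor
  · rintro (⟨s, a, z, o, s', h, rfl⟩ | ⟨a, s', h, rfl⟩ | ⟨j, hj, a, s', h, rfl⟩)
    · exact ⟨_, a, z, o, _, .inl ⟨s, s', rfl, rfl, h⟩, rfl⟩
    · exact ⟨_, a, true, .keep, s', .inr (.inl ⟨rfl, rfl, rfl, h⟩), rfl⟩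
    · exact ⟨.inr j, a, true, .keep, s', .inr (.inr ⟨j, by omega, rfl, rfl, rfl, h⟩), rfl⟩
  · rintro ⟨s, a, z, o, s', (⟨s, s', rfl, rfl, h⟩ | ⟨rfl, rfl, rfl, h⟩ |
      ⟨j, hj, rfl, rfl, rfl, h⟩), rfl⟩
    · exact .inl ⟨s, a, z, o, s', h, rfl⟩
    · exact .inr (.inl ⟨a, s', h, rfl⟩)
    · exact .inr (.inr ⟨j, by omega, a, s', h, rfl⟩)

theorem machine_isRealTime (N : ℕ) : (G.machine N).IsRealTime := by
  intro t ht
  obtain ⟨s, a, z, o, s', _, rfl⟩ := G.mem_machine_moves.1 ht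
  simp [encodeMove]

/-- A word over the alphabet of the machine, as a word over the letters of histories. -/
noncomputable def decodeWord (N : ℕ) (w : List (G.machine N).Alphabet) : List (R ⊕ K) :=
  w.map G.letterEquiv.symm

theorem accepts_iff_run {N : ℕ} (w : List (G.machine N).Alphabet) (s : G.State) (c : ℕ) :
    G.Accepts N s c (G.decodeWord N w) ↔
      ∃ l q c', (G.machine N).Run (G.encodeState s) c w l q c' ∧ q ∈ (G.machine N).final := by
  have hreal := G.machine_isRealTime N
  have hfinal : ∀ q, q ∈ (G.machine N).final ↔ ∃ s, G.Final s ∧ q = G.encodeState s :=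
    G.exists_finalStates.choose_spec
  induction w generalizing s c with
  | nil =>
    change G.Final s ↔ _
    constructor
    · intro h
      exact ⟨[], _, c, .refl _ _, (hfinal _).2 ⟨s, h, rfl⟩⟩
    · rintro ⟨l, q, c', hr, hq⟩
      cases hr with
      | refl =>
        obtain ⟨s', hs', h⟩ := (hfinal _).1 hq
        rwa [G.encodeState_injective h]
      | silent t _ _ c₁ _ l _ _ ht _ h => exact absurd h (hreal t ht)
  | cons a w ih =>
    change G.Accepts N s c (G.letterEquiv.symm a :: G.decodeWord N w) ↔ _
    simp only [Accepts, ih]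
    constructor
    · rintro ⟨o, t, c₁, hm, ho, l, q, c', hr, hq⟩
      refine ⟨o :: l, q, c', ?_, hq⟩
      exact .read _ a _ c c₁ w l q c' (G.mem_machine_moves.2 ⟨s, _, _, o, t, hm, rfl⟩) rfl
        (congrArg (fun b => some (Fin.val b)) (G.letterEquiv.apply_symm_apply a))
        (by simp [encodeMove]) ho hr
    · rintro ⟨l, q, c', hr, hq⟩
      cases hr with
      | silent t _ _ c₁ _ l _ _ ht _ h => exact absurd h (hreal t ht)
      | read t _ _ _ c₁ _ l _ _ ht hs ha hz ho hr =>
        obtain ⟨s₁, b, z, o, s', hm, rfl⟩ := G.mem_machine_moves.1 ht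
        have h1 := G.encodeState_injective hs
        subst h1
        have h2 : G.letterEquiv b = a := Fin.ext (by simpa [encodeMove] using ha)
        subst h2
        refine ⟨o, s', c₁, ?_, ho, l, q, c', hr, hq⟩
        have h3 : z = decide (c = 0) := by
          rw [Bool.eq_iff_iff, decide_eq_true_eq]; exact hz
        rw [Equiv.symm_apply_apply, ← h3]
        exact hm

theorem mem_machine_language {N : ℕ} (w : List (G.machine N).Alphabet) :
    w ∈ (G.machine N).language ↔
      ¬ G.History G.start (Pi.single G.input N) (G.decodeWord N w) := by
  rw [← accepts_start_iff, accepts_iff_run]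
  rfl

/-- Falling states lead only to falling states and never increase the counter, and the others never
decrease it. Hence after a decrement the run stays in falling states. -/
theorem run_pairwise {N : ℕ} {q c : ℕ} {w : List (G.machine N).Alphabet} {l : List CounterOp}
    {q' c' : ℕ} (h : (G.machine N).Run q c w l q' c') :
    (∀ s, q = G.encodeState s → G.Falling s → CounterOp.inc ∉ l) ∧
      l.Pairwise fun a b => ¬ (a = .dec ∧ b = .inc) := by
  induction h with
  | refl => simp
  | silent t _ _ _ _ _ _ _ ht _ h => exact absurd h (G.machine_isRealTime N t ht)
  | read t a q c c₁ w l q' c' ht hs ha hz ho hr ih =>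
    obtain ⟨s, b, z, o, s', hm, rfl⟩ := G.mem_machine_moves.1 ht
    obtain ⟨ih1, ih2⟩ := ih
    constructor
    · rintro s₁ rfl hfall
      rw [← G.encodeState_injective hs] at hfall
      obtain ⟨h1, h2⟩ := G.move_of_falling hm hfall
      rw [List.mem_cons, not_or]
      exact ⟨fun h => h1 h.symm, ih1 _ rfl h2⟩
    · refine List.pairwise_cons.2 ⟨fun b hb => ?_, ih2⟩
      rintro ⟨h1, rfl⟩
      by_cases hfall : G.Falling s
      · exact ih1 _ rfl (G.move_of_falling hm hfall).2 hb
      · exact G.move_of_not_falling hm hfall h1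

theorem machine_isRealTimeNCM11 (N : ℕ) : (G.machine N).IsRealTimeNCM11 :=
  ⟨G.machine_isRealTime N, fun _ _ _ _ h => CounterOp.reversals_le_one (G.run_pairwise h).2⟩

end RuleSystem

/-! The machine is computable from the input. -/

/-- As `l` is fixed, `f` may depend on its elements in any way whatever, and `β` needs no coding. -/
theorem Primrec.list_filterMap_const {α β γ : Type} [Primcodable α] [Primcodable γ] (l : List β)
    (f : α → β → Option γ) (hf : ∀ b, Primrec fun a => f a b) :
    Primrec fun a => l.filterMap (f a) := by
  induction l with
  | nil => exact Primrec.const []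
  | cons b l ih =>
    refine (Primrec.list_append.comp (Primrec.optionToList.comp (hf b)) ih).of_eq fun a => ?_
    rw [List.filterMap_cons]
    cases f a b <;> rfl

namespace RuleSystem

variable {Q R K : Type} (G : RuleSystem Q R K) [DecidableEq K] [Finite Q] [Finite R] [Finite K]

theorem primrec_chainNext (a : R ⊕ K) :
    Primrec fun j => (G.chainNext j a).map G.encodeState := by
  rcases a with r | k
  · refine (Primrec.nat_casesOn₁ none
      (Primrec.const (some (G.encodeState (.inl .reject))))).of_eq fun j => ?_
    cases j <;> rfl
  · by_cases hk : k = G.input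
    · refine (Primrec.nat_casesOn₁ (some (G.encodeState (.inl .reject)))
        (Primrec.option_some.comp (Primrec.nat_add.comp
          (Primrec.const (Nat.card (Control Q R K G.bound))) Primrec.id))).of_eq fun j => ?_
      cases j
      · rfl
      · simp [chainNext, hk, encodeState]
    · refine (Primrec.nat_casesOn₁ (some (G.encodeState (.inl .reject)))
        (Primrec.const (some (G.encodeState (.inl .reject))))).of_eq fun j => ?_
      cases j
      · rfl
      · simp [chainNext, hk]

theorem primrec_chainMoves : Primrec₂ G.chainMoves := by
  refine Primrec.list_filterMap_const _ _ fun a => ?_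
  have h : Primrec₂ fun (p : ℕ × ℕ) (t : ℕ) => G.encodeMove p.1 a true .keep t := by
    have he : Primrec CounterMove.equivProd.symm := Primrec.of_equiv_symm
    have hp : Primrec fun p : (ℕ × ℕ) × ℕ =>
        (p.1.1, some (G.letterEquiv a : ℕ), true, CounterOp.keep, p.2) :=
      Primrec.pair (Primrec.fst.comp Primrec.fst) (Primrec.pair (Primrec.const _)
        (Primrec.pair (Primrec.const _) (Primrec.pair (Primrec.const _) Primrec.snd)))
    exact he.comp hp
  refine (Primrec.option_map ((G.primrec_chainNext a).comp Primrec.snd) h).of_eq fun p => ?_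
  rw [Option.map_map]
  rfl

theorem primrec_machine : Primrec G.machine := by
  have he : Primrec OneCounterMachine.equivProd.symm := Primrec.of_equiv_symm
  have hflat : Primrec fun N => (List.range (N + 1)).flatMap fun j =>
      G.chainMoves (Nat.card (Control Q R K G.bound) + j) j :=
    Primrec.list_flatMap (Primrec.list_range.comp Primrec.succ)
      (G.primrec_chainMoves.comp (Primrec.nat_add.comp (Primrec.const _) Primrec.snd) Primrec.snd)
  have hmoves : Primrec fun N => (G.machine N).moves :=
    Primrec.list_append.comp (Primrec.const _) (Primrec.list_append.comp
      (G.primrec_chainMoves.comp (Primrec.const _) Primrec.id) hflat)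
  have hp : Primrec fun N => OneCounterMachine.equivProd (G.machine N) :=
    Primrec.pair (Primrec.const _) (Primrec.pair (Primrec.const _)
      (Primrec.pair (Primrec.const _) hmoves))
  exact he.comp hp

end RuleSystem

/-! Lengths of histories of deterministic rule systems. -/

namespace RuleSystem

open StateTransition

variable {Q R K C : Type}

/-- On the configurations that satisfy `I` the rule system does the same as the step function `f`,
where `state b` and `vec b` represent the configuration `b`. The entry at `clock` counts steps. -/
structure Simulates (G : RuleSystem Q R K) (f : C → Option C) (I : C → Prop) (state : C → Q)
    (vec : C → K → ℕ) (clock : K) : Prop where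
  preserve : ∀ b b', I b → f b = some b' → I b'
  exists_rule : ∀ b b', I b → f b = some b' → ∃ r, G.ok (state b) r ∧ G.Applicable r (vec b)
  fire_eq : ∀ b r, I b → G.ok (state b) r → G.Applicable r (vec b) →
    ∃ b', f b = some b' ∧ state b' = G.dst r ∧ vec b' = G.fire r (vec b)
  clock_eq : ∀ b b', I b → f b = some b' → vec b' clock = vec b clock + 1

variable {G : RuleSystem Q R K} {f : C → Option C} {I : C → Prop} {state : C → Q}
  {vec : C → K → ℕ} {clock : K}

theorem Simulates.le_sum_vec [Fintype K] (h : G.Simulates f I state vec clock) {c : ℕ → C}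
    (hI : ∀ i, I (c i)) (hc : ∀ i, f (c i) = some (c (i + 1))) (i : ℕ) : i ≤ ∑ k, vec (c i) k := by
  have : i ≤ vec (c i) clock := by
    induction i with
    | zero => exact Nat.zero_le _
    | succ i ih =>
      rw [h.clock_eq _ _ (hI i) (hc i)]
      omega
  exact this.trans (Finset.single_le_sum (f := vec (c i)) (fun _ _ => Nat.zero_le _)
    (Finset.mem_univ clock))

variable [DecidableEq K]

theorem length_eq_sum_counts [Fintype K] (u : List K) : u.length = ∑ k, counts u k := by
  simpa [counts] using
    (Multiset.sum_count_eq_card (s := Finset.univ) (m := (u : Multiset K)) (by simp)).symm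

theorem finite_counts_eq [Fintype K] (x : K → ℕ) : {u : List K | counts u = x}.Finite := by
  refine (List.finite_length_eq K (∑ k, x k)).subset ?_
  rintro u rfl
  exact length_eq_sum_counts u

theorem exists_counts_eq [Finite K] (x : K → ℕ) : ∃ u : List K, counts u = x := by
  have := Fintype.ofFinite K
  refine ⟨Finset.univ.toList.flatMap fun k => List.replicate (x k) k, funext fun k => ?_⟩
  simp only [counts, List.count_flatMap, Function.comp_def, List.count_replicate]
  rw [Finset.sum_map_toList]
  simp

/-- Backwards from the halting configuration, which has only the empty history: a nonempty history
of `a` consists of one of finitely many orderings of a vector, one of finitely many rules, and a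
history of the successor of `a`. -/
theorem Simulates.finite_histories [Fintype K] [Finite R]
    (h : G.Simulates f I state vec clock) {a b : C} (hab : Reaches f a b) (hb : f b = none)
    (ha : I a) : {w | G.History (state a) (vec a) w}.Finite := by
  induction hab using Relation.ReflTransGen.head_induction_on with
  | refl =>
    refine (Set.finite_singleton ([] : List (R ⊕ K))).subset fun w hw => ?_
    cases hw with
    | nil => rfl
    | cons _ _ u r w h1 h2 h3 h4 =>
      obtain ⟨b', hb', _⟩ := h.fire_eq _ _ ha h2 h3
      rw [hb] at hb'
      cases hb'
  | @head a a' haa' _ ih =>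
    have ih := ih (h.preserve _ _ ha haa')
    refine ((Set.finite_singleton ([] : List (R ⊕ K))).union
      (((finite_counts_eq (vec a)).prod ((Set.finite_univ (α := R)).prod ih)).image
        fun p => p.1.map Sum.inr ++ Sum.inl p.2.1 :: p.2.2)).subset fun w hw => ?_
    cases hw with
    | nil => exact .inl rfl
    | cons _ _ u r w h1 h2 h3 h4 =>
      obtain ⟨b', hb', h5, h6⟩ := h.fire_eq _ _ ha h2 h3
      obtain rfl : a' = b' := Option.some.inj (haa'.symm.trans hb')
      refine .inr ⟨(u, r, w), ⟨h1, trivial, ?_⟩, rfl⟩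
      rw [← h5, ← h6] at h4
      exact h4

theorem exists_orbit {a : C} (ha : ∀ b, Reaches f a b → f b ≠ none) :
    ∃ c : ℕ → C, c 0 = a ∧ ∀ i, f (c i) = some (c (i + 1)) := by
  choose g hg using fun b : {b // Reaches f a b} => Option.ne_none_iff_exists'.1 (ha b b.2)
  let next : {b // Reaches f a b} → {b // Reaches f a b} := fun b => ⟨g b, b.2.tail (hg b)⟩
  let c : ℕ → {b // Reaches f a b} := fun i => next^[i] ⟨a, .refl⟩
  refine ⟨fun i => c i, rfl, fun i => ?_⟩
  rw [hg (c i)]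
  simp only [c, Function.iterate_succ_apply']
  rfl

/-- By `fire_eq`, the vectors of a history must be those of the orbit. The order of letters is free,
but the length depends only on the number `m` of steps. -/
theorem Simulates.length_history [Fintype K] (h : G.Simulates f I state vec clock) {c : ℕ → C}
    (hI : ∀ i, I (c i)) (hc : ∀ i, f (c i) = some (c (i + 1))) (w : List (R ⊕ K)) (i : ℕ)
    (hw : G.History (state (c i)) (vec (c i)) w) :
    ∃ m, w.length = ∑ j ∈ Finset.range m, (∑ k, vec (c (i + j)) k + 1) := by
  induction hn : w.length using Nat.strong_induction_on generalizing w i with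
  | _ n ih =>
    cases hw with
    | nil => exact ⟨0, by simpa using hn.symm⟩
    | cons _ _ u r w h1 h2 h3 h4 =>
      obtain ⟨b', hb', h5, h6⟩ := h.fire_eq _ _ (hI i) h2 h3
      obtain rfl : c (i + 1) = b' := Option.some.inj ((hc i).symm.trans hb')
      rw [← h5, ← h6] at h4
      simp only [List.length_append, List.length_map, List.length_cons] at hn
      obtain ⟨m, hm⟩ := ih w.length (by omega) w (i + 1) h4 rfl
      refine ⟨m + 1, ?_⟩
      rw [Finset.sum_range_succ', ← hn, hm, length_eq_sum_counts u, h1]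
      simp only [add_zero, add_assoc, add_comm 1]
      omega

theorem Simulates.exists_history [Fintype K] (h : G.Simulates f I state vec clock) {c : ℕ → C}
    (hI : ∀ i, I (c i)) (hc : ∀ i, f (c i) = some (c (i + 1))) (m i : ℕ) :
    ∃ w, G.History (state (c i)) (vec (c i)) w ∧
    w.length = ∑ j ∈ Finset.range m, (∑ k, vec (c (i + j)) k + 1) := by
  induction m generalizing i with
  | zero => exact ⟨[], .nil _ _, rfl⟩
  | succ m ih =>
    obtain ⟨w, hw, hl⟩ := ih (i + 1)
    obtain ⟨r, h2, h3⟩ := h.exists_rule _ _ (hI i) (hc i)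
    obtain ⟨b', hb', h5, h6⟩ := h.fire_eq _ _ (hI i) h2 h3
    obtain rfl : c (i + 1) = b' := Option.some.inj ((hc i).symm.trans hb')
    obtain ⟨u, hu⟩ := exists_counts_eq (vec (c i))
    rw [h5, h6] at hw
    refine ⟨_, .cons _ _ u r w hu h2 h3 hw, ?_⟩
    rw [Finset.sum_range_succ', List.length_append, List.length_map, List.length_cons, hl,
      length_eq_sum_counts u, hu]
    simp only [add_zero, add_assoc, add_comm 1]
    omega

/-- Nothing is attained strictly between `S d` and `S (d + 1)`, and these differ by more than `d`.
-/
theorem exists_long_gap {g S : ℕ → ℕ} (hS : ∀ m, S (m + 1) = S m + (g m + 1)) (hg : ∀ m, m ≤ g m)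
    (d : ℕ) : ∃ p, ∀ i < d, ∀ m, p + i ≠ S m := by
  have hmono : Monotone S := monotone_nat_of_le_succ fun m => by rw [hS]; omega
  refine ⟨S d + 1, fun i hi m => ?_⟩
  rcases le_or_gt m d with h | h
  · have := hmono h
    omega
  · have := hmono (Nat.succ_le_of_lt h)
    have h1 := hS d
    have h2 := hg d
    simp only [Nat.succ_eq_add_one] at this
    omega

variable [Finite Q] [Finite R] [Fintype K]

theorem mem_compl_machine_language {N : ℕ} (w : List (G.machine N).Alphabet) :
    w ∈ (G.machine N).languageᶜ ↔
      G.History G.start (Pi.single G.input N) (G.decodeWord N w) := by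
  rw [show w ∈ (G.machine N).languageᶜ ↔ ¬ w ∈ (G.machine N).language from Iff.rfl,
    mem_machine_language, not_not]

theorem length_decodeWord {N : ℕ} (w : List (G.machine N).Alphabet) :
    (G.decodeWord N w).length = w.length :=
  List.length_map _

theorem countWords_compl_machine_eq_zero {N n : ℕ} :
    countWords (G.machine N).languageᶜ n = 0 ↔
      ∀ w, G.History G.start (Pi.single G.input N) w → w.length ≠ n := by
  rw [countWords, Set.ncard_eq_zero ((List.finite_length_eq _ n).subset fun w hw => hw.2),
    Set.eq_empty_iff_forall_notMem]
  constructor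
  · intro h w hw hl
    obtain ⟨v, rfl⟩ : ∃ v, G.decodeWord N v = w :=
      List.map_surjective_iff.2 G.letterEquiv.symm.surjective w
    exact h v ⟨(mem_compl_machine_language v).2 hw, (length_decodeWord v).symm.trans hl⟩
  · rintro h w ⟨hw, hl⟩
    exact h _ ((mem_compl_machine_language w).1 hw) ((length_decodeWord w).trans hl)

theorem Simulates.countingRegular (h : G.Simulates f I state vec clock) {a : C} (ha : I a) {N : ℕ}
    (hs : state a = G.start) (hv : vec a = Pi.single G.input N) (hdom : (eval f a).Dom) :
    (G.machine N).language.IsRegular := by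
  obtain ⟨hab, hb⟩ := mem_eval.1 (Part.get_mem hdom)
  have hfin := h.finite_histories hab hb ha
  rw [hs, hv] at hfin
  rw [← Language.IsRegular_compl]
  refine Language.isRegular_of_finite (Set.Finite.subset (hfin.preimage (f := G.decodeWord N)
    (List.map_injective_iff.2 G.letterEquiv.symm.injective).injOn) fun w hw => ?_)
  exact (mem_compl_machine_language w).1 hw

theorem Simulates.not_countingRegular (h : G.Simulates f I state vec clock) {a : C} (ha : I a)
    {N : ℕ} (hs : state a = G.start) (hv : vec a = Pi.single G.input N)
    (hdom : ¬ (eval f a).Dom) :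
    ¬ CountingRegular (G.machine N).languageᶜ ∧ ¬ CountingRegular (G.machine N).language := by
  obtain ⟨c, rfl, hc⟩ := exists_orbit (f := f) (a := a) fun b hab hb =>
    hdom (Part.dom_iff_mem.2 ⟨b, mem_eval.2 ⟨hab, hb⟩⟩)
  have hI : ∀ i, I (c i) := fun i => by
    induction i with
    | zero => exact ha
    | succ i ih => exact h.preserve _ _ ih (hc i)
  let S : ℕ → ℕ := fun m => ∑ j ∈ Finset.range m, (∑ k, vec (c j) k + 1)
  have hgap : ∀ d, ∃ m, ∀ i < d, countWords (G.machine N).languageᶜ (m + i) = 0 := fun d => by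
    obtain ⟨p, hp⟩ := exists_long_gap (S := S) (g := fun m => ∑ k, vec (c m) k)
      (fun m => Finset.sum_range_succ _ _) (h.le_sum_vec hI hc) d
    refine ⟨p, fun i hi => countWords_compl_machine_eq_zero.2 fun w hw hl => ?_⟩
    rw [← hs, ← hv] at hw
    obtain ⟨m, hm⟩ := h.length_history hI hc w 0 hw
    simp only [zero_add] at hm
    exact hp i hi m (hl.symm.trans hm)
  have hinf : ¬ ∃ m, ∀ n, countWords (G.machine N).languageᶜ (m + n) = 0 := by
    rintro ⟨m, hm⟩
    obtain ⟨w, hw, hl⟩ := h.exists_history hI hc m 0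
    rw [hs, hv] at hw
    -- Each step contributes at least its rule letter.
    have hmw : m ≤ w.length := by
      rw [hl]
      calc m = ∑ j ∈ Finset.range m, 1 := by simp
        _ ≤ _ := Finset.sum_le_sum fun j _ => by omega
    have := hm (w.length - m)
    rw [Nat.add_sub_cancel' hmw] at this
    exact countWords_compl_machine_eq_zero.1 this w hw rfl
  refine ⟨fun hr => hinf (hr.eventually_zero hgap), fun hr => hinf ?_⟩
  refine CountingRegular.eventually_zero_of_compl ?_ hgap
  rwa [compl_compl]

end RuleSystem

/-! Stack machines as rule systems. -/

/-- An injective numbering of `Option A` that starts with `none`. -/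
noncomputable def digit {A : Type} [Finite A] : Option A → ℕ
  | none => 0
  | some a => Finite.equivFin A a + 1

theorem digit_lt {A : Type} [Finite A] (o : Option A) : digit o < Nat.card A + 1 := by
  cases o with
  | none => exact Nat.succ_pos _
  | some a => exact Nat.succ_lt_succ (Finite.equivFin A a).isLt

theorem digit_injective {A : Type} [Finite A] : Function.Injective (digit (A := A)) := by
  rintro (_ | a) (_ | b) h
  · rfl
  · simp [digit] at h
  · simp [digit] at h
  · simp only [digit, Nat.add_right_cancel_iff] at h
    rw [(Finite.equivFin A).injective (Fin.ext h)]

/-- A stack as a number whose digits are the entries, starting with the least significant one. -/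
noncomputable def stackCode {A : Type} [Finite A] : List A → ℕ
  | [] => 0
  | a :: l => (Nat.card A + 1) * stackCode l + digit (some a)

/-- Since `none` has digit `0`, the empty stack needs no separate case: the top is always the
residue modulo the base, and the quotient codes the tail. -/
theorem stackCode_eq {A : Type} [Finite A] (l : List A) :
    stackCode l = (Nat.card A + 1) * stackCode l.tail + digit l.head? := by
  cases l <;> simp [stackCode, digit]

theorem mul_add_digit_inj {A : Type} [Finite A] {x y : ℕ} {o o' : Option A}
    (h : (Nat.card A + 1) * x + digit o = (Nat.card A + 1) * y + digit o') : o = o' := by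
  have h' := congrArg (· % (Nat.card A + 1)) h
  simp only [Nat.mul_add_mod, Nat.mod_eq_of_lt (digit_lt _)] at h'
  exact digit_injective h'

namespace StackMachine

open Turing StateTransition

variable {K A Λ σ : Type}

abbrev Stmt (K A Λ σ : Type) : Type := TM2.Stmt (fun _ : K => A) Λ σ

/-- A configuration between two elementary statements, with a clock. -/
structure Config (K A Λ σ : Type) where
  stmt : Option (Stmt K A Λ σ)
  var : σ
  stk : K → List A
  time : ℕ

/-- The stack entry that a statement inspects. -/
def top : Stmt K A Λ σ → (K → List A) → Option A
  | .peek k _ _, S => (S k).head?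
  | .pop k _ _, S => (S k).head?
  | _, _ => none

/-- The control after a statement that has inspected the stack entry `o`. -/
def nextControl (M : Λ → Stmt K A Λ σ) :
    Stmt K A Λ σ → σ → Option A → Option (Stmt K A Λ σ) × σ
  | .push _ _ q, v, _ => (some q, v)
  | .peek _ f q, v, o => (some q, f v o)
  | .pop _ f q, v, o => (some q, f v o)
  | .load f q, v, _ => (some q, f v)
  | .branch f q₁ q₂, v, _ => (some (cond (f v) q₁ q₂), v)
  | .goto f, v, _ => (some (M (f v)), v)
  | .halt, v, _ => (none, v)

/-- The statement `s` inspects a stack entry, or `o` is `none`. -/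
def Usable : Stmt K A Λ σ → Option A → Prop
  | .peek _ _ _, _ => True
  | .pop _ _ _, _ => True
  | _, o => o = none

theorem usable_top (s : Stmt K A Λ σ) (S : K → List A) : Usable s (top s S) := by
  cases s <;> trivial

abbrev ControlState (M : Λ → Stmt K A Λ σ) (S : Finset Λ) : Type :=
  {s // s ∈ TM2.stmts M S} × σ

-- Statements form an infinite type, so the control is cut down to the finite set `TM2.stmts M S`.
-- The fallback `none` is not used on configurations satisfying the invariant, which stay inside
-- this set.
open Classical in
noncomputable def toControlState (M : Λ → Stmt K A Λ σ) (S : Finset Λ)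
    (p : Option (Stmt K A Λ σ) × σ) : ControlState M S :=
  (if h : p.1 ∈ TM2.stmts M S then ⟨p.1, h⟩ else ⟨none, by simp [TM2.stmts]⟩, p.2)

theorem toControlState_of_mem {M : Λ → Stmt K A Λ σ} {S : Finset Λ} {s : Option (Stmt K A Λ σ)}
    (hs : s ∈ TM2.stmts M S) (v : σ) : toControlState M S (s, v) = (⟨s, hs⟩, v) := by
  simp [toControlState, hs]

/-! ### Execution of stack machines one elementary statement at a time. -/

section

variable [DecidableEq K]

def nextStk : Stmt K A Λ σ → σ → (K → List A) → K → List A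
  | .push k f _, v, S => Function.update S k (f v :: S k)
  | .pop k _ _, _, S => Function.update S k (S k).tail
  | _, _, S => S

def smallStep (M : Λ → Stmt K A Λ σ) (c : Config K A Λ σ) : Option (Config K A Λ σ) :=
  c.stmt.map fun s =>
    ⟨(nextControl M s c.var (top s c.stk)).1, (nextControl M s c.var (top s c.stk)).2,
      nextStk s c.var c.stk, c.time + 1⟩

/-- The two models of configurations. -/
def Corresponds (M : Λ → Stmt K A Λ σ) (c : TM2.Cfg (fun _ : K => A) Λ σ) (d : Config K A Λ σ) :
    Prop :=
  d.stmt = c.l.map M ∧ d.var = c.var ∧ d.stk = c.stk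

/-- One step of `TM2.step` runs a whole statement up to its jump or halt, so it amounts to one or
more small steps. -/
theorem exists_reaches_stepAux (M : Λ → Stmt K A Λ σ) (s : Stmt K A Λ σ) (v : σ) (S : K → List A)
    (t : ℕ) : ∃ d, Corresponds M (TM2.stepAux s v S) d ∧
      Reaches₁ (smallStep M) ⟨some s, v, S, t⟩ d := by
  induction s generalizing v S t with
  | goto f => exact ⟨_, ⟨rfl, rfl, rfl⟩, .single rfl⟩
  | halt => exact ⟨_, ⟨rfl, rfl, rfl⟩, .single rfl⟩
  | branch f q₁ q₂ ih₁ ih₂ =>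
    cases hf : f v with
    | true =>
      obtain ⟨d, h1, h2⟩ := ih₁ v S (t + 1)
      exact ⟨d, by simpa [hf] using h1,
        .head (by simp [smallStep, nextControl, nextStk, hf]) h2⟩
    | false =>
      obtain ⟨d, h1, h2⟩ := ih₂ v S (t + 1)
      exact ⟨d, by simpa [hf] using h1,
        .head (by simp [smallStep, nextControl, nextStk, hf]) h2⟩
  | push k f q ih =>
    obtain ⟨d, h1, h2⟩ := ih v (Function.update S k (f v :: S k)) (t + 1)
    exact ⟨d, h1, .head rfl h2⟩
  | peek k f q ih =>
    obtain ⟨d, h1, h2⟩ := ih (f v (S k).head?) S (t + 1)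
    exact ⟨d, h1, .head rfl h2⟩
  | pop k f q ih =>
    obtain ⟨d, h1, h2⟩ := ih (f v (S k).head?) (Function.update S k (S k).tail) (t + 1)
    exact ⟨d, h1, .head rfl h2⟩
  | load f q ih =>
    obtain ⟨d, h1, h2⟩ := ih (f v) S (t + 1)
    exact ⟨d, h1, .head rfl h2⟩

theorem respects_smallStep (M : Λ → Stmt K A Λ σ) :
    Respects (TM2.step M) (smallStep M) (Corresponds M) := by
  rintro ⟨_ | l, v, S⟩ ⟨s, v', S', t⟩ ⟨h1, h2, h3⟩
  · simp only [Option.map_none] at h1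
    subst h1
    rfl
  · simp only [Option.map_some] at h1 h2 h3
    subst h1 h2 h3
    exact exists_reaches_stepAux M (M l) v' S' t

theorem smallStep_mem_stmts {M : Λ → Stmt K A Λ σ} {S : Finset Λ}
    (hS : ∀ l ∈ S, TM2.SupportsStmt S (M l)) {c d : Config K A Λ σ} (hc : c.stmt ∈ TM2.stmts M S)
    (h : smallStep M c = some d) : d.stmt ∈ TM2.stmts M S := by
  classical
  obtain ⟨_ | s, v, T, t⟩ := c
  · cases h
  cases h
  have hsub : ∀ q, q ∈ TM2.stmts₁ s → some q ∈ TM2.stmts M S := fun q hq => TM2.stmts_trans hq hc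
  cases s with
  | goto f =>
    have hsupp : TM2.SupportsStmt S (TM2.Stmt.goto f : Stmt K A Λ σ) := by
      simp only [TM2.stmts, Finset.some_mem_insertNone, Finset.mem_biUnion] at hc
      obtain ⟨l, hl, hq⟩ := hc
      exact TM2.stmts₁_supportsStmt_mono hq (hS l hl)
    simp only [TM2.stmts, nextControl, Finset.some_mem_insertNone, Finset.mem_biUnion]
    exact ⟨f v, hsupp v, TM2.stmts₁_self⟩
  | halt => simp [TM2.stmts, nextControl]
  | branch f q₁ q₂ =>
    refine hsub _ ?_
    cases f v <;> simp [TM2.stmts₁, TM2.stmts₁_self]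
  | _ => exact hsub _ (by simp [TM2.stmts₁, TM2.stmts₁_self])

end

/-! ### Elementary statements as affine rules on stack codes. -/

variable [DecidableEq K] [Finite A]

/-- The factors and summands of the rule for a statement that inspects the stack entry `o`: the
entry `p.1 * y + p.2.1` is replaced by `p.2.2.1 * y + p.2.2.2`. -/
noncomputable def coeffs : Stmt K A Λ σ → σ → Option A → K → ℕ × ℕ × ℕ × ℕ
  | .push k f _, v, _, k' => if k' = k then (1, 0, Nat.card A + 1, digit (some (f v)))
      else (1, 0, 1, 0)
  | .peek k _ _, _, o, k' => if k' = k then (Nat.card A + 1, digit o, Nat.card A + 1, digit o)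
      else (1, 0, 1, 0)
  | .pop k _ _, _, o, k' => if k' = k then (Nat.card A + 1, digit o, 1, 0) else (1, 0, 1, 0)
  | _, _, _, _ => (1, 0, 1, 0)

theorem coeffs_bound (s : Stmt K A Λ σ) (v : σ) (o : Option A) (k : K) :
    0 < (coeffs s v o k).1 ∧ 0 < (coeffs s v o k).2.2.1 ∧
      (coeffs s v o k).1 + (coeffs s v o k).2.1 ≤ 2 * (Nat.card A + 1) ∧
      (coeffs s v o k).2.2.1 + (coeffs s v o k).2.2.2 ≤ 2 * (Nat.card A + 1) := by
  have h1 := digit_lt o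
  cases s with
  | push k' f q =>
    have h2 := digit_lt (some (f v))
    simp only [coeffs]
    split_ifs <;> refine ⟨?_, ?_, ?_, ?_⟩ <;> simp only <;> omega
  | peek k' f q => simp only [coeffs]; split_ifs <;> refine ⟨?_, ?_, ?_, ?_⟩ <;> simp only <;> omega
  | pop k' f q => simp only [coeffs]; split_ifs <;> refine ⟨?_, ?_, ?_, ?_⟩ <;> simp only <;> omega
  | _ => refine ⟨?_, ?_, ?_, ?_⟩ <;> simp only [coeffs] <;> omega

/-- On the stack concerned, `y` codes the tail for `peek` and `pop`, and the whole stack for `push`.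
-/
theorem exists_quotient (s : Stmt K A Λ σ) (v : σ) (S : K → List A) (k : K) :
    ∃ y, stackCode (S k) =
        (coeffs s v (top s S) k).1 * y + (coeffs s v (top s S) k).2.1 ∧
      stackCode (nextStk s v S k) =
        (coeffs s v (top s S) k).2.2.1 * y + (coeffs s v (top s S) k).2.2.2 := by
  cases s with
  | push k' f q =>
    refine ⟨stackCode (S k), ?_⟩
    by_cases hk : k = k'
    · subst hk; simp [coeffs, nextStk, stackCode]
    · simp [coeffs, nextStk, hk]
  | peek k' f q =>
    by_cases hk : k = k'
    · subst hk
      exact ⟨stackCode (S k).tail, by simpa [coeffs, top] using stackCode_eq (S k),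
        by simpa [coeffs, top, nextStk] using stackCode_eq (S k)⟩
    · exact ⟨stackCode (S k), by simp [coeffs, nextStk, hk]⟩
  | pop k' f q =>
    by_cases hk : k = k'
    · subst hk
      exact ⟨stackCode (S k).tail, by simpa [coeffs, top] using stackCode_eq (S k),
        by simp [coeffs, top, nextStk]⟩
    · exact ⟨stackCode (S k), by simp [coeffs, nextStk, hk]⟩
  | _ => exact ⟨stackCode (S k), by simp [coeffs, nextStk]⟩

/-- For `peek` and `pop` the rule fixes the residue of the stack code modulo the base, which is the
digit of the top. Thus an affine condition replaces the inspection of a stack and leaves only one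
usable rule. -/
theorem eq_top {s : Stmt K A Λ σ} {v : σ} {S : K → List A} {o : Option A} (ho : Usable s o)
    (h : ∀ k, ∃ y, stackCode (S k) = (coeffs s v o k).1 * y + (coeffs s v o k).2.1) :
    o = top s S := by
  cases s with
  | peek k f q =>
    obtain ⟨y, hy⟩ := h k
    rw [stackCode_eq] at hy
    have ht : (S k).head? = o := mul_add_digit_inj (by simpa [coeffs] using hy)
    exact ht.symm
  | pop k f q =>
    obtain ⟨y, hy⟩ := h k
    rw [stackCode_eq] at hy
    have ht : (S k).head? = o := mul_add_digit_inj (by simpa [coeffs] using hy)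
    exact ht.symm
  | _ => exact ho

/-- The entries of the vector are the codes of the stacks and the clock. -/
noncomputable def vec (c : Config K A Λ σ) : Option K → ℕ
  | none => c.time
  | some k => stackCode (c.stk k)

noncomputable def ruleCoeffs {M : Λ → Stmt K A Λ σ} {S : Finset Λ}
    (r : ControlState M S × Option A) : Option K → ℕ × ℕ × ℕ × ℕ
  | none => (1, 0, 1, 1)
  | some k => r.1.1.1.elim (1, 0, 1, 0) fun s => coeffs s r.1.2 r.2 k

theorem ruleCoeffs_bound {M : Λ → Stmt K A Λ σ} {S : Finset Λ}
    (r : ControlState M S × Option A) (k : Option K) :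
    0 < (ruleCoeffs r k).1 ∧ 0 < (ruleCoeffs r k).2.2.1 ∧
      (ruleCoeffs r k).1 + (ruleCoeffs r k).2.1 ≤ 2 * (Nat.card A + 1) ∧
      (ruleCoeffs r k).2.2.1 + (ruleCoeffs r k).2.2.2 ≤ 2 * (Nat.card A + 1) := by
  obtain ⟨⟨⟨_ | s, hs⟩, v⟩, o⟩ := r
  · cases k <;> refine ⟨?_, ?_, ?_, ?_⟩ <;> simp only [ruleCoeffs, Option.elim_none] <;> omega
  · cases k with
    | none => refine ⟨?_, ?_, ?_, ?_⟩ <;> simp only [ruleCoeffs] <;> omega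
    | some k => exact coeffs_bound s v o k

/-- The rule system of a stack machine that uses only the labels in `S`. -/
noncomputable def ruleSystem (M : Λ → Stmt K A Λ σ) (S : Finset Λ) (l₀ : Λ) (v₀ : σ) (k₀ : K) :
    RuleSystem (ControlState M S) (ControlState M S × Option A) (Option K) where
  start := toControlState M S (some (M l₀), v₀)
  input := some k₀
  ok q r := r.1 = q ∧ ∃ s, q.1.1 = some s ∧ Usable s r.2
  dst r := toControlState M S (r.1.1.1.elim (none, r.1.2) fun s => nextControl M s r.1.2 r.2)
  inMul r k := (ruleCoeffs r k).1
  inAdd r k := (ruleCoeffs r k).2.1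
  outMul r k := (ruleCoeffs r k).2.2.1
  outAdd r k := (ruleCoeffs r k).2.2.2
  inMul_pos r k := (ruleCoeffs_bound r k).1
  outMul_pos r k := (ruleCoeffs_bound r k).2.1
  bound := 2 * (Nat.card A + 1)
  in_le r k := (ruleCoeffs_bound r k).2.2.1
  out_le r k := (ruleCoeffs_bound r k).2.2.2

theorem simulates (M : Λ → Stmt K A Λ σ) (S : Finset Λ) (l₀ : Λ) (v₀ : σ) (k₀ : K)
    (hS : ∀ l ∈ S, TM2.SupportsStmt S (M l)) :
    (ruleSystem M S l₀ v₀ k₀).Simulates (smallStep M) (fun c => c.stmt ∈ TM2.stmts M S)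
      (fun c => toControlState M S (c.stmt, c.var)) vec none := by
  have key : ∀ (s : Stmt K A Λ σ) (hs : some s ∈ TM2.stmts M S) (v : σ) (T : K → List A) (t : ℕ)
      (k : Option K), ∃ y,
      vec (⟨some s, v, T, t⟩ : Config K A Λ σ) k =
        (ruleCoeffs (M := M) (S := S) ((⟨some s, hs⟩, v), top s T) k).1 * y +
          (ruleCoeffs (M := M) (S := S) ((⟨some s, hs⟩, v), top s T) k).2.1 ∧
      vec (⟨(nextControl M s v (top s T)).1, (nextControl M s v (top s T)).2, nextStk s v T,
          t + 1⟩ : Config K A Λ σ) k =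
        (ruleCoeffs (M := M) (S := S) ((⟨some s, hs⟩, v), top s T) k).2.2.1 * y +
          (ruleCoeffs (M := M) (S := S) ((⟨some s, hs⟩, v), top s T) k).2.2.2 := by
    intro s hs v T t k
    cases k with
    | none => exact ⟨t, by simp [vec, ruleCoeffs], by simp [vec, ruleCoeffs]⟩
    | some k => exact exists_quotient s v T k
  refine ⟨fun b b' hb h => smallStep_mem_stmts hS hb h, ?_, ?_, ?_⟩
  · rintro ⟨_ | s, v, T, t⟩ b' hb h
    · cases h
    · refine ⟨((⟨some s, hb⟩, v), top s T), ⟨(toControlState_of_mem hb v).symm, s, ?_,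
        usable_top s T⟩, fun k => ?_⟩
      · simp only [toControlState_of_mem hb]
      · obtain ⟨y, hy, _⟩ := key s hb v T t k
        exact (RuleSystem.exists_quotient_iff.1 hy).1
  · rintro ⟨s', v, T, t⟩ ⟨q, o⟩ hb ⟨hq, s, hs, ho⟩ happ
    simp only at hb hq hs ho
    rw [toControlState_of_mem hb] at hs hq
    simp only at hs
    subst hs hq
    have htop : o = top s T := by
      refine eq_top (v := v) ho fun k => ?_
      exact ⟨_, happ (some k)⟩
    subst htop
    refine ⟨_, rfl, rfl, funext fun k => ?_⟩
    obtain ⟨y, hy, hy'⟩ := key s hb v T t k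
    rw [RuleSystem.fire, ← (RuleSystem.exists_quotient_iff.1 hy).2]
    exact hy'
  · rintro ⟨_ | s, v, T, t⟩ b' hb h
    · cases h
    · cases h
      rfl

/-- Stack machines reduce to counter machines. -/
theorem exists_counterMachine [Finite K] [Finite σ] (M : Λ → Stmt K A Λ σ) (S : Finset Λ) {l₀ : Λ}
    (hl₀ : l₀ ∈ S) (v₀ : σ) (k₀ : K) (hS : ∀ l ∈ S, TM2.SupportsStmt S (M l)) :
    ∃ F : ℕ → OneCounterMachine, Primrec F ∧ (∀ N, (F N).IsRealTimeNCM11) ∧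
      ∀ L : List A,
        ((eval (TM2.step M) ⟨some l₀, v₀, Function.update (fun _ => []) k₀ L⟩).Dom →
          (F (stackCode L)).language.IsRegular) ∧
        (¬ (eval (TM2.step M) ⟨some l₀, v₀, Function.update (fun _ => []) k₀ L⟩).Dom →
          ¬ CountingRegular (F (stackCode L)).languageᶜ ∧
          ¬ CountingRegular (F (stackCode L)).language) := by
  classical
  have := Fintype.ofFinite K
  let G := ruleSystem M S l₀ v₀ k₀
  refine ⟨G.machine, G.primrec_machine, G.machine_isRealTimeNCM11, fun L => ?_⟩
  let a : Config K A Λ σ := ⟨some (M l₀), v₀, Function.update (fun _ => []) k₀ L, 0⟩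
  have ha : a.stmt ∈ TM2.stmts M S := by
    simp only [a, TM2.stmts, Finset.some_mem_insertNone, Finset.mem_biUnion]
    exact ⟨l₀, hl₀, TM2.stmts₁_self⟩
  have hsim := simulates M S l₀ v₀ k₀ hS
  have hv : vec a = Pi.single G.input (stackCode L) := by
    ext k
    rcases k with _ | k
    · rfl
    · by_cases hk : k = k₀
      · subst hk; simp [vec, a, G, ruleSystem]
      · simp [vec, a, G, ruleSystem, hk, stackCode]
  rw [← tr_eval_dom (respects_smallStep M) (a₂ := a) ⟨rfl, rfl, rfl⟩]
  exact ⟨hsim.countingRegular ha rfl hv, hsim.not_countingRegular ha rfl hv⟩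

end StackMachine

/-! Reduction of the halting problem. -/

section

open Turing Turing.PartrecToTM2

theorem trNat_eq_cons {n : ℕ} (hn : n ≠ 0) :
    trNat n = (if n % 2 = 0 then Γ'.bit0 else Γ'.bit1) :: trNat (n / 2) := by
  have key : ∀ (b : Bool) (m : ℕ), Nat.bit b m ≠ 0 →
      trNat (Nat.bit b m) = (if b = false then Γ'.bit0 else Γ'.bit1) :: trNat m := by
    intro b m h
    simp only [trNat, ← Num.ofNat'_eq, Num.ofNat'_bit]
    have hm : m ≠ 0 ∨ b = true := by
      rcases Nat.eq_zero_or_pos m with rfl | hm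
      · right; cases b <;> simp_all
      · left; omega
    have h0 : Num.ofNat' m = 0 → m = 0 := fun h => by
      rw [Num.ofNat'_eq] at h
      exact_mod_cast h
    generalize Num.ofNat' m = p at h0 ⊢
    cases b
    · cases p with
      | zero => simp [h0 rfl] at hm
      | pos p => rfl
    · cases p <;> rfl
  have h := key n.bodd n.div2 (by rwa [Nat.bit_bodd_div2])
  rw [Nat.bit_bodd_div2, Nat.div2_val] at h
  rw [h, Nat.mod_two_of_bodd]
  cases n.bodd <;> simp

theorem primrec_stackCode_trList : Primrec fun n : ℕ => stackCode (trList [n]) := by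
  let b : ℕ := Nat.card Γ' + 1
  -- The list `l` holds the values below `n = l.length`. Removing the lowest binary digit, which is
  -- on top of the stack, leaves the stack of `n / 2`.
  let g : List ℕ → Option ℕ := fun l =>
    if l.length = 0 then some (stackCode [Γ'.cons]) else
      (l[l.length / 2]?).map fun x =>
        b * x + if l.length % 2 = 0 then digit (some Γ'.bit0) else digit (some Γ'.bit1)
  have hg : Primrec g := by
    have hlen : Primrec fun l : List ℕ => l.length := Primrec.list_length
    refine Primrec.ite (Primrec.eq.comp hlen (Primrec.const 0)) (Primrec.const _) ?_
    refine Primrec.option_map (Primrec.list_getElem?.comp Primrec.id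
      (Primrec.nat_div.comp hlen (Primrec.const 2))) ?_
    have hd : Primrec fun l : List ℕ =>
        if l.length % 2 = 0 then digit (some Γ'.bit0) else digit (some Γ'.bit1) :=
      Primrec.ite (Primrec.eq.comp (Primrec.nat_mod.comp hlen (Primrec.const 2))
        (Primrec.const 0)) (Primrec.const _) (Primrec.const _)
    exact Primrec.nat_add.comp (Primrec.nat_mul.comp (Primrec.const b) Primrec.snd)
      (hd.comp Primrec.fst)
  have h : Primrec₂ fun (_ : Unit) (n : ℕ) => stackCode (trList [n]) := by
    refine Primrec.nat_strong_rec _ (g := fun _ => g) (hg.comp Primrec.snd) fun _ n => ?_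
    simp only [g, List.length_map, List.length_range]
    rcases Nat.eq_zero_or_pos n with rfl | hn
    · simp
    · have hlt : n / 2 < n := Nat.div_lt_self hn one_lt_two
      simp only [hn.ne', if_false, List.getElem?_map, List.getElem?_range hlt, Option.map_some,
        trList, Option.some.injEq]
      rw [trNat_eq_cons hn.ne', List.cons_append, stackCode]
      split_ifs <;> rfl
  exact h.comp (Primrec.const ()) Primrec.id

/-- With a universal code the stack machine is fixed, and `p` enters only through the initial
contents of one stack. -/
theorem exists_universal_code : ∃ c : ToPartrec.Code, ∀ p : Nat.Partrec.Code,
    (c.eval [Encodable.encode p]).Dom ↔ (p.eval 0).Dom := by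
  have hf : Partrec fun n : ℕ => (Denumerable.ofNat Nat.Partrec.Code n).eval 0 :=
    Nat.Partrec.Code.eval_part.comp (Computable.ofNat _) (Computable.const 0)
  obtain ⟨c, hc⟩ := ToPartrec.Code.exists_code (Nat.Partrec'.part_iff₁.2 hf)
  refine ⟨c, fun p => ?_⟩
  have := hc ⟨[Encodable.encode p], rfl⟩
  rw [this]
  simp [List.Vector.head]

theorem exists_reduction : ∃ F : Nat.Partrec.Code → OneCounterMachine, Computable F ∧
    (∀ p, (F p).IsRealTimeNCM11) ∧
    (∀ p, CountingRegular (F p).languageᶜ ↔ (p.eval 0).Dom) ∧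
    ∀ p, CountingRegular (F p).language ↔ (p.eval 0).Dom := by
  obtain ⟨c, hc⟩ := exists_universal_code
  have hsupp := tr_supports c Cont'.halt
  have : Finite K' := Finite.of_injective
    (fun k : K' => (decide (k = .main), decide (k = .rev), decide (k = .aux)))
    fun a b h => by cases a <;> cases b <;> simp_all
  obtain ⟨F, hF, hclass, h⟩ := StackMachine.exists_counterMachine tr (codeSupp c Cont'.halt)
    hsupp.1 none K'.main hsupp.2
  have hdom : ∀ p : Nat.Partrec.Code,
      (StateTransition.eval (TM2.step tr) ⟨some (trNormal c Cont'.halt), none,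
        Function.update (fun _ => []) K'.main (trList [Encodable.encode p])⟩).Dom ↔
      (p.eval 0).Dom := by
    intro p
    have hst : Function.update (fun _ => []) K'.main (trList [Encodable.encode p]) =
        K'.elim (trList [Encodable.encode p]) [] [] [] := by
      ext k
      cases k <;> simp [Function.update]
    have := tr_eval c [Encodable.encode p]
    rw [init, ← hst] at this
    rw [← hc p, this]
    rfl
  refine ⟨fun p => F (stackCode (trList [Encodable.encode p])),
    (hF.comp (primrec_stackCode_trList.comp Primrec.encode)).to_comp, fun p => hclass _,
    fun p => ⟨fun hr => ?_, fun hd => ?_⟩, fun p => ⟨fun hr => ?_, fun hd => ?_⟩⟩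
  · by_contra hd
    exact ((h _).2 (mt (hdom p).1 hd)).1 hr
  · exact ((h _).1 ((hdom p).2 hd)).compl.countingRegular
  · by_contra hd
    exact ((h _).2 (mt (hdom p).1 hd)).2 hr
  · exact ((h _).1 ((hdom p).2 hd)).countingRegular

end

/-- As `F` takes values in `C` only, the partial algorithm composed with `F` is total and would
decide halting on input `0`. -/
theorem not_decidableProblem_of_reduction {α : Type} [Primcodable α] {C P : α → Prop}
    {F : Nat.Partrec.Code → α} (hF : Computable F) (hC : ∀ p, C (F p))
    (hP : ∀ p, P (F p) ↔ (p.eval 0).Dom) : ¬ DecidableProblem C P := by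
  classical
  rintro ⟨f, hf, h⟩
  refine ComputablePred.halting_problem 0 ⟨Classical.decPred _, ?_⟩
  refine (hf.comp hF).of_eq fun p => ?_
  obtain ⟨b, hb, hbP⟩ := h (F p) (hC p)
  rw [Part.eq_some_iff.2 hb]
  refine congrArg Part.some ?_
  rw [Bool.eq_iff_iff, decide_eq_true_iff, hbP, hP]

theorem mainTheorem7 :
    ¬ DecidableProblem OneCounterMachine.IsRealTimeNCM11
        (fun M : OneCounterMachine => CountingRegular (M.language)ᶜ) ∧
    ¬ DecidableProblem OneCounterMachine.IsRealTimeNCM11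
        (fun M : OneCounterMachine => CountingRegular M.language) := by
  obtain ⟨F, hF, hC, h1, h2⟩ := exists_reduction
  exact ⟨not_decidableProblem_of_reduction hF hC h1, not_decidableProblem_of_reduction hF hC h2⟩
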